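/- **Comparison functions.** A function $a:\mathbb R_+\to\mathbb R_+$ is of class $\mathcal K$ if it is continuous, strictly increasing and $a(0)=0$, and of class $\mathcal K_\infty$ if moreover $a(r)\to\infty$ as $r\to\infty$. It is of class $\mathcal L$ if it is continuous, nonincreasing and tends to $0$ at $\infty$. A continuous $g:\mathbb R_+^2\to\mathbb R_+$ is of class $\mathcal{KL}$ if $g(\cdot,\ell)\in\mathcal K$ for every $\ell\ge 0$ and, for every $r\ge0$, $g(r,\cdot)$ is nonincreasing and tends to $0$ at $\infty$. Write $D^+y(t)=\limsup_{h\to0^+}h^{-1}(y(t+h)-y(t))$. **Setting.** Let $H,U$ be (real or complex) Hilbert spaces, let $A$ with domain $\operatorname{dom}(A)\subset H$ be the generator of a $C_0$-semigroup $T$ on $H$ with $\|T(t)\|\le Me^{\nu_0 t}$ for $t\ge 0$ ($M\ge1$, $\nu_0>0$), and let $B\in\mathcal B(U,H)$. Let $F\in\mathcal B(H,U)$ be compact and such that $A+BF$ generates a $C_0$-semigroup $T_{BF}$ with $\|T_{BF}(t)\|\le N e^{-\xi t}$ for $t\ge0$ ($N\ge1$, $\xi>0$). Let $f:U\to U$ be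 such that $f\circ F$ is globally Lipschitz and $\|f(Fx)-Fx\|\le\theta_f\|x\|$ for all $x\in H$, where $\theta_f>0$ satisfies $\theta_f\,MN\|B\|<\xi$. Consider $$\dot x(t)=Ax(t)+Bf(u(t)),\qquad x(0)=x_0 .\tag{1}$$ All solutions are mild solutions on $[0,\infty)$. **Sampled-data control.** For $\tau>0$ the sampled-data controller is $u(t)=Fx(k\tau)$, $t\in[k\tau,(k+1)\tau)$, $k\in\mathbb N_0$. We say that $G\ge 1$ and $\chi>0$ are *stability constants for $\tau$* if every solution of (1) under this controller satisfies $\|x(t)\|\le Ge^{-\chi t}\|x_0\|$ for all $t\ge0$. **Lyapunov function.** A continuous $V:H\to\mathbb R_+$ is a coercive ISS Lyapunov function with functions $\psi_1,\psi_2,\alpha,\gamma\in\mathcal K_\infty$ if $\psi_1(\|x\|)\le V(x)\le\psi_2(\|x\|)$ for all $x\in H$, and for all $x\in H$ and all locally Lipschitz $d:\mathbb R_+\to H$ the solution $\phi$ of $\dot\phi=A\phi+Bf(F\phi)+d$, $\phi(0)=x$, satisfies $$D^+\big(V\circ\phi\big)(0)\le-\alpha(V(x))+\gamma(\|d(0)\|).$$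 **Event-triggered control.** Given such $V$, and $\tau>0$, $\sigma\in(0,1)$, the switching-based event-triggered controller is $$u(t)=Fx(t_k),\quad t\in[t_k,t_{k+1}),\qquad t_0=0,$$ $$t_{k+1}=\inf\big\{t\ge t_k+\tau:\ \gamma\big(\|B[f(Fx(t_k))-f(Fx(t))]\|\big)\ge\sigma\,\alpha(V(x(t)))\big\},\tag{2}$$ with $\inf\emptyset=\infty$ (there are no further updates once $t_{k+1}=\infty$). **Iterated gains.** Let $\kappa\in\mathcal{KL}$ be a function as given by the comparison principle, i.e. such that every continuous $y:\mathbb R_+\to\mathbb R_+$ with $D^+y(t)\le-(1-\sigma)\alpha(y(t))$ for all $t\ge0$ satisfies $y(t)\le\kappa(y(0),t)$ for all $t\ge0$. Given stability constants $G,\chi$ for $\tau$, put $$\rho(m,n)=\psi_1^{-1}\big(\kappa(\psi_2(Ge^{-\chi\tau}m),n)\big),$$ $$\mathcal R^{(1)}(m,\{n_1\})=\rho(m,n_1),\qquad \mathcal R^{(N)}(m,\{n_j\}_{j=1}^{N})=\rho\big(\mathcal R^{(N-1)}(m,\{n_j\}_{j=1}^{N-1}),n_N\big),\quad N\ge2 .$$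 **Theorem.** 1. There is $\tau_*>0$ such that stability constants exist for every $\tau\in(0,\tau_*)$. 2. Let $\tau>0$ admit stability constants $G\ge1$, $\chi>0$ (in particular any $\tau\in(0,\tau_*)$ does), let $V$ be a coercive ISS Lyapunov function with functions $\psi_1,\psi_2,\alpha,\gamma$, let $\sigma\in(0,1)$, and let $\kappa$ be as above. Suppose there are $\mu\in\mathcal{KL}$ and $\omega\in\mathcal L$ such that for all $N\ge1$, $m\ge0$ and $n_1,\dots,n_N\ge0$ $$\mathcal R^{(N)}(m,\{n_j\}_{j=1}^{N})\le\mu\Big(\omega(N)\,m,\max_{1\le j\le N}n_j\Big).$$ Then the origin of the closed loop (1)+(2) is uniformly globally asymptotically stable: there is $\nu\in\mathcal{KL}$ such that for every $x_0\in H$ the closed loop has a solution on $[0,\infty)$, and every such solution $x$ satisfies $$\|x(t)\|\le\nu(\|x_0\|,t),\qquad t\ge0 .$$ -/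

import Mathlib

open Filter Topology Set MeasureTheory
open scoped NNReal

/-! ### Comparison functions, Dini derivative -/

/-- Class `K∞`: continuous, strictly increasing, zero at zero, unbounded. -/
structure IsClassKInf (a : ℝ≥0 → ℝ≥0) : Prop where
  continuous : Continuous a
  strictMono : StrictMono a
  map_zero : a 0 = 0
  tendsto : Tendsto a atTop atTop

/-- Class `L`: continuous, nonincreasing, tending to zero. -/
structure IsClassL (w : ℝ≥0 → ℝ≥0) : Prop where
  continuous : Continuous w
  antitone : Antitone w
  tendsto : Tendsto w atTop (𝓝 0)

/-- Class `KL`: jointly continuous, of class `K` in the first variable, and nonincreasing with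
limit zero in the second variable. (At `r = 0` strict decrease is impossible.) -/
structure IsClassKL (g : ℝ≥0 → ℝ≥0 → ℝ≥0) : Prop where
  continuous : Continuous (fun p : ℝ≥0 × ℝ≥0 => g p.1 p.2)
  strictMono : ∀ l, StrictMono (fun r => g r l)
  map_zero : ∀ l, g 0 l = 0
  antitone : ∀ r, Antitone (g r)
  tendsto : ∀ r, Tendsto (g r) atTop (𝓝 0)

/-- The right upper Dini derivative `D⁺y(t)`, as an extended real number. -/
noncomputable def upperRightDini (y : ℝ → ℝ) (t : ℝ) : EReal :=
  limsup (fun h : ℝ => (((y (t + h) - y t) / h : ℝ) : EReal)) (𝓝[>] 0)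

/-- `κ` is a bound from the comparison principle for `D⁺y ≤ -(1-σ) α(y)`: every continuous
`y : ℝ₊ → ℝ₊` satisfying this inequality on `ℝ₊` has `y(t) ≤ κ(y(0), t)`. -/
def IsComparisonBound (σ : ℝ) (α : ℝ≥0 → ℝ≥0) (κ : ℝ≥0 → ℝ≥0 → ℝ≥0) : Prop :=
  ∀ y : ℝ → ℝ≥0, ContinuousOn y (Ici 0) →
    (∀ t : ℝ, 0 ≤ t →
      upperRightDini (fun s => (y s : ℝ)) t ≤ ((-(1 - σ) * (α (y t) : ℝ) : ℝ) : EReal)) →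
    ∀ t : ℝ≥0, y t ≤ κ (y 0) t

/-- `ρ(m,n) = ψ₁⁻¹(κ(ψ₂(G e^{-χτ} m), n))`; `ψ₁` will be of class `K∞`, hence bijective. -/
noncomputable def gainRho (ψ₁ ψ₂ : ℝ≥0 → ℝ≥0) (κ : ℝ≥0 → ℝ≥0 → ℝ≥0) (G χ τ : ℝ)
    (m n : ℝ≥0) : ℝ≥0 :=
  Function.invFun ψ₁ (κ (ψ₂ (Real.toNNReal (G * Real.exp (-χ * τ)) * m)) n)

/-- The iterates `R^(N)(m, {n₁, …, n_N})` of `ρ`, with `R^(0) = m`. The numbers `n_j` are the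
values of a sequence `n`, of which only the entries `1, …, N` are used. -/
def gainIterate (ρ : ℝ≥0 → ℝ≥0 → ℝ≥0) (m : ℝ≥0) (n : ℕ → ℝ≥0) : ℕ → ℝ≥0
  | 0 => m
  | N + 1 => ρ (gainIterate ρ m n N) (n (N + 1))

section Systems

variable {𝕜 : Type*} [RCLike 𝕜]
  {H : Type*} [NormedAddCommGroup H] [InnerProductSpace 𝕜 H] [NormedSpace ℝ H]
  {U : Type*} [NormedAddCommGroup U] [InnerProductSpace 𝕜 U]

/-! ### Semigroups and mild solutions -/

/-- `T(t)`, `t ≥ 0`, is a `C₀`-semigroup (values at negative times are irrelevant). -/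
structure IsC0Semigroup (T : ℝ → H →L[𝕜] H) : Prop where
  map_zero : T 0 = ContinuousLinearMap.id 𝕜 H
  map_add : ∀ s t : ℝ, 0 ≤ s → 0 ≤ t → T (s + t) = (T s).comp (T t)
  continuousOn : ∀ x : H, ContinuousOn (fun t => T t x) (Ici 0)

/-- The unbounded operator `A` is the infinitesimal generator of `T`: `x ∈ dom A` and `A x = y`
if and only if `h⁻¹ (T(h) x - x) → y` as `h → 0⁺`. -/
def IsGenerator (A : H →ₗ.[𝕜] H) (T : ℝ → H →L[𝕜] H) : Prop :=
  ∀ x y : H, (x, y) ∈ A.graph ↔ Tendsto (fun h : ℝ => h⁻¹ • (T h x - x)) (𝓝[>] 0) (𝓝 y)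

/-- `x` is the mild solution on `[0,∞)` of `ẋ = A x + g(t)`, `x(0) = x₀`, with `A` the generator
of `T` and `g` locally integrable. -/
structure IsMildSolution (T : ℝ → H →L[𝕜] H) (g : ℝ → H) (x₀ : H) (x : ℝ → H) : Prop where
  integrable : ∀ t : ℝ, 0 ≤ t → IntervalIntegrable g volume 0 t
  continuousOn : ContinuousOn x (Ici 0)
  eq : ∀ t : ℝ, 0 ≤ t → x t = T t x₀ + ∫ s in (0 : ℝ)..t, T (t - s) (g s)

/-- Exponential stability, with constants `G` and `χ`, of `ẋ = A x + B f(u)` under the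
sampled-data controller `u(t) = F x(kτ)` for `t ∈ [kτ, (k+1)τ)`, `k = 0, 1, 2, …`. -/
def SampledDataExpStable (T : ℝ → H →L[𝕜] H) (B : U →L[𝕜] H) (f : U → U) (F : H →L[𝕜] U)
    (τ G χ : ℝ) : Prop :=
  ∀ (x₀ : H) (u : ℝ → U) (x : ℝ → H),
    (∀ k : ℕ, ∀ t ∈ Ico (k * τ) ((k + 1) * τ), u t = F (x (k * τ))) →
    IsMildSolution T (fun t => B (f (u t))) x₀ x →
    ∀ t : ℝ, 0 ≤ t → ‖x t‖ ≤ G * Real.exp (-χ * t) * ‖x₀‖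

/-- `V` is a coercive ISS Lyapunov function, with the functions `ψ₁, ψ₂, α, γ`, for the disturbed
system `ẋ = A x + B f(F x) + d`, where `d : ℝ₊ → H` is locally Lipschitz and `φ = φ(·; x, d)` is
the mild solution. -/
structure IsCoerciveISSLyapunov (T : ℝ → H →L[𝕜] H) (B : U →L[𝕜] H) (f : U → U)
    (F : H →L[𝕜] U) (V : H → ℝ≥0) (ψ₁ ψ₂ α γ : ℝ≥0 → ℝ≥0) : Prop where
  continuous : Continuous V
  psi₁ : IsClassKInf ψ₁
  psi₂ : IsClassKInf ψ₂
  alpha : IsClassKInf α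
  gamma : IsClassKInf γ
  lower : ∀ x : H, ψ₁ ‖x‖₊ ≤ V x
  upper : ∀ x : H, V x ≤ ψ₂ ‖x‖₊
  dissipation : ∀ (x : H) (d φ : ℝ → H), LocallyLipschitzOn (Ici 0) d →
    IsMildSolution T (fun t => B (f (F (φ t))) + d t) x φ →
    upperRightDini (fun t => (V (φ t) : ℝ)) 0 ≤
      ((-(α (V x) : ℝ) + (γ ‖d 0‖₊ : ℝ) : ℝ) : EReal)

/-- `x` is a solution from `x₀` of `ẋ = A x + B f(u)` in closed loop with the switching-based
event-triggered controller, with input `u` and update times `t k ∈ [0, ∞]`. The infimum of the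
empty set is `⊤`; once `t k = ⊤`, all later times are `⊤` and carry no condition on `u`. -/
structure IsEventTriggeredSolution (T : ℝ → H →L[𝕜] H) (B : U →L[𝕜] H) (f : U → U)
    (F : H →L[𝕜] U) (V : H → ℝ≥0) (α γ : ℝ≥0 → ℝ≥0) (τ σ : ℝ)
    (x₀ : H) (t : ℕ → EReal) (u : ℝ → U) (x : ℝ → H) : Prop where
  time_zero : t 0 = 0
  time_succ : ∀ k : ℕ, t (k + 1) = sInf ((fun s : ℝ => (s : EReal)) ''
    {s : ℝ | t k + (τ : EReal) ≤ (s : EReal) ∧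
      σ * (α (V (x s)) : ℝ) ≤ (γ ‖B (f (F (x (t k).toReal)) - f (F (x s)))‖₊ : ℝ)})
  control : ∀ (k : ℕ) (s : ℝ), t k ≤ (s : EReal) → (s : EReal) < t (k + 1) →
    u s = F (x (t k).toReal)
  mild : IsMildSolution T (fun s => B (f (u s))) x₀ x

end Systems

/-!
# Stability of sampled-data and event-triggered control for a semigroup system

**Sampled-data control.** Over one sampling period the state follows the flow of a constant input,
and `IsC0Semigroup.affineFlow_eq_perturbed` rewrites that flow through the exponentially stable
semigroup `S` generated by `A + B F`, driven by the deviation `B f(F x(kτ)) - B F x(t)`. Besides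
the sector error, this deviation contains `F (x(kτ) - x(t))`, which is small relative to `‖x(kτ)‖`
uniformly in the state: for compact `F` on a Hilbert space `‖F (T(h) - 1)‖ → 0` as `h → 0⁺`
(`IsC0Semigroup.eventually_norm_compact_comp_le`), since the adjoint semigroup is strongly
continuous. Hence the deviation is at most `‖B‖ (θ + η) ‖x(kτ)‖` with `η` as small as desired, and
each period contracts the family of bounds `‖S(r) x(kτ)‖ ≤ N e^{-ξ r} R`, `r ≥ 0`, by a factor
less than `1` (`norm_apply_heldFlow_le`).

**Event-triggered control.** During the waiting time `τ` after an update, the closed loop coincides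
with the sampled-data system. Afterwards, and until the next update, the triggering rule turns the
dissipation inequality into `D⁺V ≤ -(1-σ) α(V)`, with the update error as the disturbance. The
dissipation inequality admits only locally Lipschitz disturbances, and the update error is one only
for initial states in the domain of the generator; `IsCoerciveISSLyapunov.heldFlow_le` therefore
proves the decay of `V` there first and extends it by density. The two phases together apply the
gain `ρ` once per update interval, so the state is bounded by iterated gains whose decay times,
together with the waiting times, add up to the elapsed time
(`IsEventTriggeredSolution.exists_gainIterate`). At time `s`, either at least `√s` gains were
applied or one decay time is at least `√s - τ` (`gain_le_of_elapsed`); the gain hypothesis makes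
the bound small in both cases, which yields a `KL` estimate.
-/

-- the type class assumptions on `H` and `U` are fixed once for all lemmas
set_option linter.unusedSectionVars false

section Semigroup

variable {𝕜 : Type*} [RCLike 𝕜]
  {H : Type*} [NormedAddCommGroup H] [InnerProductSpace 𝕜 H] [NormedSpace ℝ H]
  [IsScalarTower ℝ 𝕜 H] [CompleteSpace H]

/-! ### Orbits of a strongly continuous semigroup -/

namespace IsC0Semigroup

variable {T : ℝ → H →L[𝕜] H}

theorem apply_zero (hT : IsC0Semigroup T) (x : H) : T 0 x = x := by
  rw [hT.map_zero]; rfl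

theorem apply_add (hT : IsC0Semigroup T) {s t : ℝ} (hs : 0 ≤ s) (ht : 0 ≤ t) (x : H) :
    T (s + t) x = T s (T t x) := by
  rw [hT.map_add s t hs ht]; rfl

/-- Local boundedness, by the uniform boundedness principle. -/
theorem exists_bound (hT : IsC0Semigroup T) (a : ℝ) :
    ∃ C, 0 ≤ C ∧ ∀ t ∈ Icc 0 a, ‖T t‖ ≤ C := by
  obtain ⟨C, hC⟩ := banach_steinhaus (g := fun t : Icc (0 : ℝ) a => T t) (by
    intro x
    obtain ⟨C, hC⟩ := isCompact_Icc.exists_bound_of_continuousOn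
      ((hT.continuousOn x).mono (fun t (ht : t ∈ Icc 0 a) => ht.1))
    exact ⟨C, fun t => hC t t.2⟩)
  exact ⟨max C 0, le_max_right _ _, fun t ht => (hC ⟨t, ht⟩).trans (le_max_left _ _)⟩

/-- Joint continuity of `(t, x) ↦ T(t) x` on `[0, ∞) × H`; negative times are clamped to `0`. -/
theorem continuous_uncurry (hT : IsC0Semigroup T) :
    Continuous (fun p : ℝ × H => T (max p.1 0) p.2) := by
  rw [continuous_iff_continuousAt]
  rintro ⟨t, x⟩
  obtain ⟨C, hC0, hC⟩ := hT.exists_bound (max t 0 + 1)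
  have horb : Continuous (fun s : ℝ => T (max s 0) x) :=
    (hT.continuousOn x).comp_continuous (by fun_prop) (fun s => mem_Ici.2 (le_max_right _ _))
  have h1 : Tendsto (fun p : ℝ × H => T (max p.1 0) x) (𝓝 (t, x)) (𝓝 (T (max t 0) x)) :=
    (horb.comp continuous_fst).tendsto (t, x)
  have h2 : Tendsto (fun p : ℝ × H => T (max p.1 0) (p.2 - x)) (𝓝 (t, x)) (𝓝 0) := by
    apply squeeze_zero_norm' (a := fun p : ℝ × H => C * ‖p.2 - x‖)
    · have : ∀ᶠ p : ℝ × H in 𝓝 (t, x), p.1 < t + 1 :=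
        (continuous_fst.tendsto (t, x)).eventually (gt_mem_nhds (by simp))
      filter_upwards [this] with p hp
      refine (T (max p.1 0)).le_of_opNorm_le (hC _ ⟨le_max_right _ _, ?_⟩) _
      have := le_max_left t 0
      have := le_max_right t 0
      exact max_le (by linarith) (by linarith)
    · have : Continuous (fun p : ℝ × H => C * ‖p.2 - x‖) := by fun_prop
      simpa using this.tendsto (t, x)
  have := h1.add h2
  simpa [ContinuousAt] using this

theorem continuous_apply (hT : IsC0Semigroup T) {X : Type*} [TopologicalSpace X] {f : X → ℝ}
    {g : X → H} (hf : Continuous f) (hg : Continuous g) :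
    Continuous (fun p => T (max (f p) 0) (g p)) :=
  hT.continuous_uncurry.comp (hf.prodMk hg)

/-- The integrand of a mild solution formula is integrable. -/
theorem intervalIntegrable_convolution (hT : IsC0Semigroup T) {g : ℝ → H} {a b s : ℝ}
    (hab : a ≤ b) (hbs : b ≤ s) (hg : IntervalIntegrable g volume a b) :
    IntervalIntegrable (fun r => T (s - r) (g r)) volume a b := by
  rw [intervalIntegrable_iff_integrableOn_Ioc_of_le hab] at hg ⊢
  obtain ⟨C, hC0, hC⟩ := hT.exists_bound (s - a)
  have hmeas : AEStronglyMeasurable (fun r => T (max (s - r) 0) (g r))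
      (volume.restrict (Ioc a b)) := by
    refine hT.continuous_uncurry.comp_aestronglyMeasurable (f := fun r => (s - r, g r)) ?_
    exact AEStronglyMeasurable.prodMk
      (by fun_prop : Continuous fun r : ℝ => s - r).aestronglyMeasurable hg.aestronglyMeasurable
  have hEq : ∀ r ∈ Ioc a b, T (max (s - r) 0) (g r) = T (s - r) (g r) := by
    intro r hr
    rw [max_eq_left (by linarith [hr.2])]
  refine Integrable.mono' (hg.norm.const_mul C) (hmeas.congr ?_) ?_
  · exact (ae_restrict_mem measurableSet_Ioc).mono hEq
  · filter_upwards [ae_restrict_mem measurableSet_Ioc] with r hr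
    exact (T (s - r)).le_of_opNorm_le (hC _ ⟨by linarith [hr.2], by linarith [hr.1]⟩) _

theorem intervalIntegrable_orbit (hT : IsC0Semigroup T) (b : H) {a c : ℝ} (ha : 0 ≤ a)
    (hc : 0 ≤ c) : IntervalIntegrable (fun r => T r b) volume a c :=
  ((hT.continuousOn b).mono (by
    intro r hr
    exact (le_min ha hc).trans hr.1)).intervalIntegrable

theorem integral_orbit_eq_clamped (T : ℝ → H →L[𝕜] H) (b : H) {s : ℝ} (hs : 0 ≤ s) :
    ∫ r in (0 : ℝ)..s, T r b = ∫ r in (0 : ℝ)..s, T (max r 0) b := by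
  refine intervalIntegral.integral_congr ?_
  intro r hr
  rw [uIcc_of_le hs] at hr
  simp [max_eq_left hr.1]

theorem tendsto_slope_integral_orbit (hT : IsC0Semigroup T) (b : H) {s : ℝ} (hs : 0 ≤ s) :
    Tendsto (fun h : ℝ => h⁻¹ • ((∫ r in (0 : ℝ)..(s + h), T r b) - ∫ r in (0 : ℝ)..s, T r b))
      (𝓝[>] 0) (𝓝 (T s b)) := by
  have hc : Continuous (fun r : ℝ => T (max r 0) b) :=
    hT.continuous_apply continuous_id continuous_const
  have := (hc.integral_hasStrictDerivAt 0 s).hasDerivAt.tendsto_slope_zero_right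
  rw [max_eq_left hs] at this
  refine this.congr' ?_
  filter_upwards [self_mem_nhdsWithin] with h hh
  rw [integral_orbit_eq_clamped T b hs,
    integral_orbit_eq_clamped T b (add_nonneg hs (le_of_lt hh))]

theorem tendsto_slope_integral_orbit_zero (hT : IsC0Semigroup T) (b : H) :
    Tendsto (fun h : ℝ => h⁻¹ • ∫ r in (0 : ℝ)..h, T r b) (𝓝[>] 0) (𝓝 b) := by
  simpa [hT.apply_zero] using hT.tendsto_slope_integral_orbit b le_rfl

theorem apply_integral_orbit (hT : IsC0Semigroup T) (b : H) {s h : ℝ} (hs : 0 ≤ s)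
    (hh : 0 ≤ h) : T h (∫ r in (0 : ℝ)..s, T r b) =
      (∫ r in (0 : ℝ)..(s + h), T r b) - ∫ r in (0 : ℝ)..h, T r b := by
  rw [← ContinuousLinearMap.intervalIntegral_comp_comm _
    (hT.intervalIntegrable_orbit b le_rfl hs)]
  rw [intervalIntegral.integral_interval_sub_left
    (hT.intervalIntegrable_orbit b le_rfl (by positivity))
    (hT.intervalIntegrable_orbit b le_rfl hh)]
  have : ∫ r in (0 : ℝ)..s, T h (T r b) = ∫ r in (0 : ℝ)..s, T (r + h) b := by
    refine intervalIntegral.integral_congr ?_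
    intro r hr
    rw [uIcc_of_le hs] at hr
    simp only [add_comm r h]
    rw [hT.apply_add hh hr.1]
  rw [this, intervalIntegral.integral_comp_add_right (fun r => T r b) h, zero_add]

theorem norm_integral_orbit_le {C s : ℝ} (hs : 0 ≤ s) (hC : ∀ t ∈ Icc 0 s, ‖T t‖ ≤ C) (b : H) :
    ‖∫ r in (0 : ℝ)..s, T r b‖ ≤ C * ‖b‖ * s := by
  have := intervalIntegral.norm_integral_le_of_norm_le_const (a := 0) (b := s) (C := C * ‖b‖)
    (f := fun r => T r b) (by
      intro r hr
      rw [uIoc_of_le hs] at hr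
      exact (T r).le_of_opNorm_le (hC r ⟨hr.1.le, hr.2⟩) b)
  rwa [sub_zero, abs_of_nonneg hs] at this

end IsC0Semigroup

/-! ### The generator -/

theorem hasDerivWithinAt_Ioi_of_tendsto {w : ℝ → H} {w' : H} {s : ℝ}
    (h : Tendsto (fun h : ℝ => h⁻¹ • (w (s + h) - w s)) (𝓝[>] 0) (𝓝 w')) :
    HasDerivWithinAt w w' (Ioi s) s := by
  rw [hasDerivWithinAt_iff_tendsto_slope' (by simp)]
  have hmap : Tendsto (fun t : ℝ => t - s) (𝓝[>] s) (𝓝[>] 0) := by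
    refine tendsto_nhdsWithin_iff.2 ⟨?_, ?_⟩
    · have : Continuous (fun t : ℝ => t - s) := by fun_prop
      simpa using (this.tendsto s).mono_left nhdsWithin_le_nhds
    · filter_upwards [self_mem_nhdsWithin] with t ht
      exact sub_pos.2 (mem_Ioi.1 ht)
  refine (h.comp hmap).congr fun t => ?_
  simp [slope]

/-- `y` is the value at `x` of the infinitesimal generator of `T`, as a limit of difference
quotients; this avoids carrying the domain of an unbounded operator. -/
def HasGeneratorValue (T : ℝ → H →L[𝕜] H) (x y : H) : Prop :=
  Tendsto (fun h : ℝ => h⁻¹ • (T h x - x)) (𝓝[>] 0) (𝓝 y)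

namespace IsC0Semigroup

variable {T S : ℝ → H →L[𝕜] H}

theorem hasGeneratorValue_apply (hT : IsC0Semigroup T) {x y : H} (h : HasGeneratorValue T x y)
    {s : ℝ} (hs : 0 ≤ s) : HasGeneratorValue T (T s x) (T s y) := by
  have h1 := ((T s).continuous.tendsto y).comp h
  refine h1.congr' ?_
  filter_upwards [self_mem_nhdsWithin] with r hr
  have hr0 : (0 : ℝ) ≤ r := le_of_lt hr
  simp only [Function.comp]
  rw [ContinuousLinearMap.map_smul_of_tower, map_sub, ← hT.apply_add hs hr0,
    ← hT.apply_add hr0 hs, add_comm]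

theorem hasGeneratorValue_integral (hT : IsC0Semigroup T) (b : H) {s : ℝ} (hs : 0 ≤ s) :
    HasGeneratorValue T (∫ r in (0 : ℝ)..s, T r b) (T s b - b) := by
  refine ((hT.tendsto_slope_integral_orbit b hs).sub
    (hT.tendsto_slope_integral_orbit_zero b)).congr' ?_
  filter_upwards [self_mem_nhdsWithin] with h hh
  rw [hT.apply_integral_orbit b hs (le_of_lt hh), ← smul_sub]
  congr 1
  abel

/-- The domain of the generator is dense. -/
theorem dense_generator (hT : IsC0Semigroup T) : Dense {x : H | ∃ y, HasGeneratorValue T x y} := by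
  intro x
  refine mem_closure_of_tendsto (hT.tendsto_slope_integral_orbit_zero x) ?_
  filter_upwards [self_mem_nhdsWithin] with h hh
  refine ⟨h⁻¹ • (T h x - x), ?_⟩
  have := (hT.hasGeneratorValue_integral x (le_of_lt hh)).const_smul h⁻¹
  refine this.congr fun r => ?_
  rw [ContinuousLinearMap.map_smul_of_tower, ← smul_sub, smul_comm]

theorem hasDerivWithinAt_orbit (hT : IsC0Semigroup T) {x y : H} (h : HasGeneratorValue T x y)
    {s : ℝ} (hs : 0 ≤ s) : HasDerivWithinAt (fun t => T t x) (T s y) (Ioi s) s := by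
  refine hasDerivWithinAt_Ioi_of_tendsto ((hT.hasGeneratorValue_apply h hs).congr' ?_)
  filter_upwards [self_mem_nhdsWithin] with r hr
  rw [← hT.apply_add (le_of_lt hr) hs, add_comm]

theorem orbit_sub_eq_integral (hT : IsC0Semigroup T) {x y : H} (h : HasGeneratorValue T x y)
    {t : ℝ} (ht : 0 ≤ t) : T t x - x = ∫ r in (0 : ℝ)..t, T r y := by
  rw [intervalIntegral.integral_eq_sub_of_hasDeriv_right_of_le (f := fun t => T t x) ht
    ((hT.continuousOn x).mono Icc_subset_Ici_self)
    (fun s hs => hT.hasDerivWithinAt_orbit h hs.1.le)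
    (hT.intervalIntegrable_orbit y le_rfl ht), hT.apply_zero]

end IsC0Semigroup

/-! ### Mild solutions under a constant input -/

/-- The mild solution at time `s` of `ẋ = A x + b`, `x(0) = z`, for a constant `b`. -/
noncomputable def affineFlow (T : ℝ → H →L[𝕜] H) (b z : H) (s : ℝ) : H :=
  T s z + ∫ r in (0 : ℝ)..s, T r b

namespace IsC0Semigroup

variable {T S : ℝ → H →L[𝕜] H}

theorem affineFlow_zero (hT : IsC0Semigroup T) (b z : H) : affineFlow T b z 0 = z := by
  simp [affineFlow, hT.apply_zero]

theorem affineFlow_add (hT : IsC0Semigroup T) (b z : H) {s t : ℝ} (hs : 0 ≤ s) (ht : 0 ≤ t) :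
    affineFlow T b z (s + t) = affineFlow T b (affineFlow T b z s) t := by
  simp only [affineFlow]
  rw [_root_.map_add, hT.apply_integral_orbit b hs ht, ← hT.apply_add ht hs, add_comm t s]
  abel

/-- Joint continuity of the flow in the initial value and in time, for an input that depends
continuously on the initial value. -/
theorem continuous_affineFlow (hT : IsC0Semigroup T) {b : H → H} (hb : Continuous b) :
    Continuous (fun p : H × ℝ => affineFlow T (b p.1) p.1 (max p.2 0)) := by
  have h1 : Continuous (fun p : H × ℝ => T (max p.2 0) p.1) :=
    hT.continuous_apply continuous_snd continuous_fst
  have h2 : Continuous (fun p : H × ℝ => ∫ r in (0 : ℝ)..(max p.2 0), T (max r 0) (b p.1)) := by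
    refine intervalIntegral.continuous_parametric_intervalIntegral_of_continuous
      (f := fun (p : H × ℝ) r => T (max r 0) (b p.1)) ?_ (by fun_prop)
    exact hT.continuous_apply continuous_snd (by fun_prop)
  refine (h1.add h2).congr fun p => ?_
  rw [Pi.add_apply, affineFlow, integral_orbit_eq_clamped T _ (le_max_right _ _)]

theorem continuousOn_affineFlow (hT : IsC0Semigroup T) (b z : H) :
    ContinuousOn (affineFlow T b z) (Ici 0) := by
  have h := (hT.continuous_affineFlow (b := fun _ => b) continuous_const).comp
    (Continuous.prodMk_right z)
  refine h.continuousOn.congr fun s hs => ?_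
  simp [max_eq_left (show (0 : ℝ) ≤ s from hs)]

theorem norm_affineFlow_le {C s : ℝ} (hs : 0 ≤ s) (hC : ∀ t ∈ Icc 0 s, ‖T t‖ ≤ C) (b z : H) :
    ‖affineFlow T b z s‖ ≤ C * ‖z‖ + C * ‖b‖ * s :=
  (norm_add_le _ _).trans (add_le_add
    ((T s).le_of_opNorm_le (hC s ⟨hs, le_rfl⟩) z) (norm_integral_orbit_le hs hC b))

/-- From an initial value in the domain of the generator, the flow stays in the domain. -/
theorem hasGeneratorValue_affineFlow (hT : IsC0Semigroup T) {b z y : H}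
    (h : HasGeneratorValue T z y) {s : ℝ} (hs : 0 ≤ s) :
    HasGeneratorValue T (affineFlow T b z s) (T s y + (T s b - b)) := by
  refine ((hT.hasGeneratorValue_apply h hs).add (hT.hasGeneratorValue_integral b hs)).congr ?_
  intro r
  rw [affineFlow, _root_.map_add, ← smul_add]
  congr 1
  abel

/-- From an initial value in the domain of the generator, the flow is Lipschitz on bounded
time intervals. -/
theorem lipschitzOnWith_affineFlow (hT : IsC0Semigroup T) {b z y : H}
    (h : HasGeneratorValue T z y) (a : ℝ) :
    ∃ K : ℝ≥0, LipschitzOnWith K (affineFlow T b z) (Icc 0 a) := by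
  obtain ⟨C, hC0, hC⟩ := hT.exists_bound a
  have hrep : ∀ t, 0 ≤ t → affineFlow T b z t = z + ∫ r in (0 : ℝ)..t, T r (y + b) := by
    intro t ht
    have h1 := hT.orbit_sub_eq_integral h ht
    simp_rw [_root_.map_add]
    rw [intervalIntegral.integral_add (hT.intervalIntegrable_orbit y le_rfl ht)
      (hT.intervalIntegrable_orbit b le_rfl ht), ← h1, affineFlow]
    abel
  refine ⟨⟨C * ‖y + b‖, by positivity⟩, LipschitzOnWith.of_dist_le_mul ?_⟩
  intro t ht s hs
  rw [hrep t ht.1, hrep s hs.1, dist_add_left, dist_eq_norm,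
    intervalIntegral.integral_interval_sub_left
      (hT.intervalIntegrable_orbit _ le_rfl ht.1) (hT.intervalIntegrable_orbit _ le_rfl hs.1)]
  rw [Real.dist_eq]
  refine intervalIntegral.norm_integral_le_of_norm_le_const ?_
  intro r hr
  refine (T r).le_of_opNorm_le (hC r ?_) _
  have := uIoc_subset_uIcc hr
  exact ⟨(le_min hs.1 ht.1).trans this.1, this.2.trans (max_le hs.2 ht.2)⟩

theorem isMildSolution_affineFlow (hT : IsC0Semigroup T) (b z : H) :
    IsMildSolution T (fun _ => b) z (affineFlow T b z) where
  integrable _ _ := intervalIntegrable_const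
  continuousOn := hT.continuousOn_affineFlow b z
  eq t _ := by
    rw [intervalIntegral.integral_comp_sub_left (fun r => T r b) t]
    simp [affineFlow]

/-- Splitting the integral in the mild solution formula at an intermediate time. -/
theorem integral_convolution_split (hT : IsC0Semigroup T) {g : ℝ → H} {a s : ℝ} (ha : 0 ≤ a)
    (has : a ≤ s) (hg : IntervalIntegrable g volume 0 a) (hg' : IntervalIntegrable g volume a s) :
    ∫ r in (0 : ℝ)..s, T (s - r) (g r) =
      T (s - a) (∫ r in (0 : ℝ)..a, T (a - r) (g r)) + ∫ r in a..s, T (s - r) (g r) := by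
  rw [← intervalIntegral.integral_add_adjacent_intervals
    (hT.intervalIntegrable_convolution ha has hg)
    (hT.intervalIntegrable_convolution has le_rfl hg')]
  congr 1
  rw [← ContinuousLinearMap.intervalIntegral_comp_comm _
    (hT.intervalIntegrable_convolution ha le_rfl hg)]
  refine intervalIntegral.integral_congr fun r hr => ?_
  rw [uIcc_of_le ha] at hr
  rw [← hT.apply_add (by linarith) (by linarith [hr.2])]
  congr 2
  ring

theorem integral_convolution_const {g : ℝ → H} {a s : ℝ} (has : a ≤ s) {b : H}
    (hg : ∀ r ∈ Ico a s, g r = b) :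
    ∫ r in a..s, T (s - r) (g r) = ∫ r in (0 : ℝ)..(s - a), T r b := by
  have h1 : ∫ r in a..s, T (s - r) (g r) = ∫ r in a..s, T (s - r) b := by
    refine intervalIntegral.integral_congr_ae ?_
    have : ∀ᵐ r : ℝ, r ≠ s := by simp [ae_iff]
    filter_upwards [this] with r hr hr'
    rw [uIoc_of_le has] at hr'
    rw [hg r ⟨hr'.1.le, lt_of_le_of_ne hr'.2 hr⟩]
  rw [h1, intervalIntegral.integral_comp_sub_left (fun r => T r b) s]
  simp

/-- While its input is constant, a mild solution follows the flow of that input. -/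
theorem eq_affineFlow_of_const (hT : IsC0Semigroup T) {g : ℝ → H} {x₀ : H} {x : ℝ → H}
    (hx : IsMildSolution T g x₀ x) {a s : ℝ} (ha : 0 ≤ a) (has : a ≤ s) {b : H}
    (hg : ∀ r ∈ Ico a s, g r = b) : x s = affineFlow T b (x a) (s - a) := by
  have hi : IntervalIntegrable g volume a s :=
    (hx.integrable a ha).symm.trans (hx.integrable s (ha.trans has))
  rw [hx.eq s (ha.trans has), hx.eq a ha, affineFlow,
    hT.integral_convolution_split ha has (hx.integrable a ha) hi,
    integral_convolution_const has hg, _root_.map_add, ← hT.apply_add (by linarith) ha,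
    sub_add_cancel, add_assoc]

end IsC0Semigroup

end Semigroup

section Variation

variable {𝕜 : Type*} [RCLike 𝕜]
  {H : Type*} [NormedAddCommGroup H] [InnerProductSpace 𝕜 H] [NormedSpace ℝ H]
  [IsScalarTower ℝ 𝕜 H] [CompleteSpace H]

/-! ### Variation of constants for a bounded perturbation of the generator -/

/-- Variation of constants: under a constant input, the flow of the generator of `T` is expressed
through the semigroup `S` whose generator is that of `T` plus the bounded operator `L`. For initial
values in the domain, `s ↦ S(t-s) φ(s)` is differentiated; the rest is density. -/
theorem IsC0Semigroup.affineFlow_eq_perturbed {T S : ℝ → H →L[𝕜] H} (hT : IsC0Semigroup T)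
    (hS : IsC0Semigroup S) (L : H →L[𝕜] H)
    (hgen : ∀ x y, HasGeneratorValue T x y → HasGeneratorValue S x (y + L x))
    (b z : H) {t : ℝ} (ht : 0 ≤ t) :
    affineFlow T b z t =
      S t z + ∫ s in (0 : ℝ)..t, S (t - s) (b - L (affineFlow T b z s)) := by
  have hφ := hT.continuous_affineFlow (b := fun _ => b) continuous_const
  -- clamping the times at `0` turns continuity on half-lines into joint continuity
  have hclamp : ∀ z, ∫ s in (0 : ℝ)..t, S (t - s) (b - L (affineFlow T b z s)) =
      ∫ s in (0 : ℝ)..t, S (max (t - s) 0) (b - L (affineFlow T b z (max s 0))) := by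
    intro z
    refine intervalIntegral.integral_congr fun s hs => ?_
    rw [uIcc_of_le ht] at hs
    simp only [max_eq_left hs.1, max_eq_left (sub_nonneg.2 hs.2)]
  have hcint : Continuous fun p : H × ℝ =>
      S (max (t - p.2) 0) (b - L (affineFlow T b p.1 (max p.2 0))) :=
    hS.continuous_apply (by fun_prop) (continuous_const.sub (L.continuous.comp hφ))
  have hmain : ∀ z, affineFlow T b z (max t 0) = S t z +
      ∫ s in (0 : ℝ)..t, S (max (t - s) 0) (b - L (affineFlow T b z (max s 0))) := by
    have hc1 : Continuous fun z => affineFlow T b z (max t 0) :=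
      hφ.comp (Continuous.prodMk_left t)
    have hc2 : Continuous fun z => S t z +
        ∫ s in (0 : ℝ)..t, S (max (t - s) 0) (b - L (affineFlow T b z (max s 0))) :=
      (S t).continuous.add
        (intervalIntegral.continuous_parametric_intervalIntegral_of_continuous
          (f := fun z s => S (max (t - s) 0) (b - L (affineFlow T b z (max s 0))))
          hcint continuous_const)
    refine fun z => congrFun (Continuous.ext_on hT.dense_generator hc1 hc2 ?_) z
    rintro z ⟨y, hz⟩
    have hcz : Continuous fun s : ℝ => affineFlow T b z (max s 0) :=
      hφ.comp (Continuous.prodMk_right z)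
    have hcw : Continuous fun s : ℝ => S (max (t - s) 0) (affineFlow T b z (max s 0)) :=
      hS.continuous_apply (by fun_prop) hcz
    -- the semigroup law yields right derivatives only, which the fundamental theorem accepts
    have hint := intervalIntegral.integral_eq_sub_of_hasDeriv_right_of_le
      (f' := fun s => S (max (t - s) 0) (b - L (affineFlow T b z (max s 0)))) ht
      hcw.continuousOn (fun s hs => ?_)
      ((hcint.comp (Continuous.prodMk_right z)).intervalIntegrable 0 t)
    · simp only [hint]
      simp [hT.affineFlow_zero, hS.apply_zero, ht]
    · apply hasDerivWithinAt_Ioi_of_tendsto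
      have hs0 : 0 ≤ s := hs.1.le
      have hval := hT.hasGeneratorValue_affineFlow (b := b) hz hs0
      have hlim := (hval.add (hT.tendsto_slope_integral_orbit_zero b)).sub (hgen _ _ hval)
      have hsh : Tendsto (fun h : ℝ => t - s - h) (𝓝[>] 0) (𝓝 (t - s)) := by
        have : Continuous fun h : ℝ => t - s - h := by fun_prop
        simpa using (this.tendsto 0).mono_left nhdsWithin_le_nhds
      have hcomp := (hS.continuous_uncurry.tendsto (t - s, _)).comp (hsh.prodMk_nhds hlim)
      have hv : ∀ v w : H, v + b - (v + w) = b - w := fun v w => by abel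
      simp only [max_eq_left hs0] at hcomp ⊢
      rw [hv] at hcomp
      refine hcomp.congr' ?_
      filter_upwards [Ioo_mem_nhdsGT (sub_pos.2 hs.2)] with h hh
      have hh0 : 0 ≤ h := hh.1.le
      have hts : 0 ≤ t - s - h := by linarith [hh.2]
      simp only [Function.comp]
      rw [max_eq_left (add_nonneg hs0 hh0), show t - (s + h) = t - s - h by ring,
        max_eq_left hts, max_eq_left (by linarith : 0 ≤ t - s), hT.affineFlow_add b z hs0 hh0]
      conv_rhs => rw [show t - s = (t - s - h) + h by ring]
      rw [hS.apply_add hts hh0, add_sub_cancel_right, ← map_sub,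
        ← ContinuousLinearMap.map_smul_of_tower, ← smul_add, ← smul_sub]
      congr 2
      rw [show affineFlow T b (affineFlow T b z s) h =
        T h (affineFlow T b z s) + ∫ r in (0 : ℝ)..h, T r b from rfl]
      abel
  rw [hclamp, ← hmain, max_eq_left ht]

/-- Adding `B F` to the generator `A` changes its values accordingly. -/
theorem hasGeneratorValue_of_vadd {A : H →ₗ.[𝕜] H} {T S : ℝ → H →L[𝕜] H} {L : H →L[𝕜] H}
    (hA : IsGenerator A T) (hS : IsGenerator ((L : H →ₗ[𝕜] H) +ᵥ A) S) (x y : H)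
    (h : HasGeneratorValue T x y) : HasGeneratorValue S x (y + L x) := by
  refine (hS x (y + L x)).1 ?_
  obtain ⟨v, hv, hAv⟩ := (LinearPMap.mem_graph_iff _).1 ((hA x y).2 h)
  dsimp only at hv hAv
  subst hv hAv
  refine (LinearPMap.mem_graph_iff _).2 ⟨⟨v, by rw [LinearPMap.vadd_domain]; exact v.2⟩, rfl, ?_⟩
  rw [LinearPMap.vadd_apply]
  exact add_comm _ _

/-! ### Gluing constant-input solutions -/

/-- A function may be prescribed separately on the successive intervals between times
`t 0 < t 1 < …`. -/
theorem exists_piecewise {X : Type*} [Nonempty X] {t : ℕ → EReal} (ht : Monotone t)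
    (p : ℕ → ℝ → X) :
    ∃ x : ℝ → X, ∀ (k : ℕ) (s : ℝ), t k ≤ (s : EReal) → (s : EReal) < t (k + 1) → x s = p k s := by
  classical
  refine ⟨fun s => if h : ∃ k, (s : EReal) < t (k + 1) then p (Nat.find h) s
    else Classical.arbitrary X, fun k s h1 h2 => ?_⟩
  have h : ∃ k, (s : EReal) < t (k + 1) := ⟨k, h2⟩
  have hk : Nat.find h = k := by
    refine le_antisymm (Nat.find_min' h h2) ?_
    by_contra hlt
    have := ht (Nat.succ_le_of_lt (not_le.1 hlt))
    exact absurd (Nat.find_spec h) (not_lt.2 (this.trans h1))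
  simp only [dif_pos h, hk]

/-- Update times that start at `0` and are at least `τ > 0` apart reach every time. -/
theorem exists_update_interval {t : ℕ → EReal} {τ : ℝ} (hτ : 0 < τ) (h0 : t 0 = 0)
    (hstep : ∀ k, t k + (τ : EReal) ≤ t (k + 1)) {s : ℝ} (hs : 0 ≤ s) :
    ∃ k, t k ≤ (s : EReal) ∧ (s : EReal) < t (k + 1) := by
  classical
  have hlow : ∀ k : ℕ, ((k * τ : ℝ) : EReal) ≤ t k := by
    intro k
    induction k with
    | zero => simp [h0]
    | succ k ih =>
      refine le_trans ?_ (hstep k)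
      rw [show ((k + 1 : ℕ) : ℝ) * τ = k * τ + τ by push_cast; ring, EReal.coe_add]
      gcongr
  have hex : ∃ k, (s : EReal) < t (k + 1) := by
    obtain ⟨n, hn⟩ := exists_nat_gt (s / τ)
    refine ⟨n, lt_of_lt_of_le ?_ (hlow (n + 1))⟩
    rw [EReal.coe_lt_coe_iff]
    rw [div_lt_iff₀ hτ] at hn
    push_cast
    linarith
  refine ⟨Nat.find hex, ?_, Nat.find_spec hex⟩
  rcases hk : Nat.find hex with _ | k
  · rw [h0]; exact_mod_cast hs
  · exact not_lt.1 (Nat.find_min hex (by omega))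

theorem le_add_of_real_step (a : EReal) {τ : ℝ} (hτ : 0 < τ) : a ≤ a + (τ : EReal) := by
  calc a = a + 0 := (add_zero a).symm
    _ ≤ a + (τ : EReal) := by gcongr; exact_mod_cast hτ.le

/-- Gluing: a function that follows the flow of the constant input `b k` on each interval between
consecutive update times is a mild solution for the resulting piecewise constant input. -/
theorem IsC0Semigroup.isMildSolution_of_pieces {T : ℝ → H →L[𝕜] H} (hT : IsC0Semigroup T)
    {t : ℕ → EReal} {τ : ℝ} (hτ : 0 < τ) (h0 : t 0 = 0)
    (hstep : ∀ k, t k + (τ : EReal) ≤ t (k + 1)) {b : ℕ → H} {g x : ℝ → H}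
    (hg : ∀ (k : ℕ) (s : ℝ), t k ≤ (s : EReal) → (s : EReal) < t (k + 1) → g s = b k)
    (hx : ∀ (k : ℕ) (s : ℝ), t k ≤ (s : EReal) → (s : EReal) ≤ t (k + 1) →
      x s = affineFlow T (b k) (x (t k).toReal) (s - (t k).toReal)) :
    IsMildSolution T g (x 0) x := by
  have hmono : Monotone t :=
    monotone_nat_of_le_succ fun k => (le_add_of_real_step _ hτ).trans (hstep k)
  have hpos : ∀ k, 0 ≤ t k := fun k => h0 ▸ hmono (Nat.zero_le k)
  have key : ∀ (k : ℕ) (s : ℝ), t k ≤ (s : EReal) → (s : EReal) ≤ t (k + 1) →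
      IntervalIntegrable g volume 0 s ∧ ContinuousOn x (Icc 0 s) ∧
        x s = T s (x 0) + ∫ r in (0 : ℝ)..s, T (s - r) (g r) := by
    intro k
    induction k with
    | zero =>
      intro s hs hs'
      have h0s : (0 : ℝ) ≤ s := by rw [h0] at hs; exact_mod_cast hs
      have hgs : ∀ r ∈ Ico 0 s, g r = b 0 := fun r hr =>
        hg 0 r (by rw [h0]; exact_mod_cast hr.1)
          (lt_of_lt_of_le (EReal.coe_lt_coe_iff.2 hr.2) hs')
      have hxs : ∀ r ∈ Icc 0 s, x r = affineFlow T (b 0) (x 0) r := fun r hr => by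
        have := hx 0 r (by rw [h0]; exact_mod_cast hr.1)
          ((EReal.coe_le_coe_iff.2 hr.2).trans hs')
        simpa [h0] using this
      refine ⟨?_, ?_, ?_⟩
      · refine (intervalIntegrable_const (c := b 0)).congr_ae ?_
        rw [uIoc_of_le h0s, ← restrict_Ico_eq_restrict_Ioc]
        filter_upwards [ae_restrict_mem measurableSet_Ico] with r hr
        exact (hgs r hr).symm
      · exact ((hT.continuousOn_affineFlow _ _).mono fun r hr => hr.1).congr hxs
      · rw [integral_convolution_const h0s hgs, hxs s ⟨h0s, le_rfl⟩, affineFlow, sub_zero]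
    | succ k ih =>
      intro s hs hs'
      have htop : t (k + 1) ≠ ⊤ := fun h => by
        rw [h] at hs; exact absurd hs (not_le.2 (EReal.coe_lt_top s))
      have hbot : t (k + 1) ≠ ⊥ := fun h => by
        have := hpos (k + 1); rw [h] at this; simp at this
      obtain ⟨a, ha⟩ : ∃ a : ℝ, t (k + 1) = (a : EReal) :=
        ⟨_, (EReal.coe_toReal htop hbot).symm⟩
      obtain ⟨hi, hc, he⟩ := ih a (by rw [← ha]; exact hmono (Nat.le_succ k)) ha.ge
      have h0a : 0 ≤ a := by have := hpos (k + 1); rw [ha] at this; exact_mod_cast this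
      have has : a ≤ s := by rw [ha] at hs; exact_mod_cast hs
      have hgs : ∀ r ∈ Ico a s, g r = b (k + 1) := fun r hr =>
        hg (k + 1) r (by rw [ha]; exact_mod_cast hr.1)
          (lt_of_lt_of_le (EReal.coe_lt_coe_iff.2 hr.2) hs')
      have hxs : ∀ r ∈ Icc a s, x r = affineFlow T (b (k + 1)) (x a) (r - a) := fun r hr => by
        have := hx (k + 1) r (by rw [ha]; exact_mod_cast hr.1)
          ((EReal.coe_le_coe_iff.2 hr.2).trans hs')
        simpa [ha] using this
      have hi' : IntervalIntegrable g volume a s := by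
        refine (intervalIntegrable_const (c := b (k + 1))).congr_ae ?_
        rw [uIoc_of_le has, ← restrict_Ico_eq_restrict_Ioc]
        filter_upwards [ae_restrict_mem measurableSet_Ico] with r hr
        exact (hgs r hr).symm
      refine ⟨hi.trans hi', ?_, ?_⟩
      · rw [← Icc_union_Icc_eq_Icc h0a has]
        refine hc.union_of_isClosed ?_ isClosed_Icc isClosed_Icc
        refine ContinuousOn.congr ?_ hxs
        exact (hT.continuousOn_affineFlow _ _).comp (by fun_prop) fun r hr => sub_nonneg.2 hr.1
      · rw [hT.integral_convolution_split h0a has hi hi', integral_convolution_const has hgs,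
          hxs s ⟨has, le_rfl⟩, affineFlow, he, _root_.map_add, ← hT.apply_add (by linarith) h0a,
          sub_add_cancel, add_assoc]
  have key' : ∀ s : ℝ, 0 ≤ s → IntervalIntegrable g volume 0 s ∧ ContinuousOn x (Icc 0 s) ∧
        x s = T s (x 0) + ∫ r in (0 : ℝ)..s, T (s - r) (g r) := fun s hs =>
    let ⟨k, hk1, hk2⟩ := exists_update_interval hτ h0 hstep hs
    key k s hk1 hk2.le
  refine ⟨fun s hs => (key' s hs).1, fun s hs => ?_, fun s hs => (key' s hs).2.2⟩
  have hs0 : (0 : ℝ) ≤ s := hs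
  have h1 := (key' (s + 1) (by linarith)).2.1 s ⟨hs0, by linarith⟩
  refine h1.mono_of_mem_nhdsWithin ?_
  filter_upwards [self_mem_nhdsWithin, mem_nhdsWithin_of_mem_nhds (Iio_mem_nhds (lt_add_one s))]
    with r hr hr'
  exact ⟨hr, le_of_lt hr'⟩

end Variation

section Compactness

variable {𝕜 : Type*} [RCLike 𝕜]
  {H : Type*} [NormedAddCommGroup H] [InnerProductSpace 𝕜 H] [NormedSpace ℝ H]
  [IsScalarTower ℝ 𝕜 H] [CompleteSpace H]
  {U : Type*} [NormedAddCommGroup U] [InnerProductSpace 𝕜 U] [CompleteSpace U]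

/-! ### The adjoint semigroup and compact feedback -/

open ContinuousLinearMap (adjoint)

/-- The integrated semigroup `x ↦ ∫₀ᵉ T(r) x dr` as a bounded operator. -/
theorem IsC0Semigroup.exists_integral_clm {T : ℝ → H →L[𝕜] H} (hT : IsC0Semigroup T) {e : ℝ}
    (he : 0 ≤ e) : ∃ P : H →L[𝕜] H, ∀ x, P x = ∫ r in (0 : ℝ)..e, T r x := by
  obtain ⟨C, hC0, hC⟩ := hT.exists_bound e
  have hsmul : ∀ (c : 𝕜) (x : H),
      ∫ r in (0 : ℝ)..e, T r (c • x) = c • ∫ r in (0 : ℝ)..e, T r x := by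
    intro c x
    simp
  refine ⟨LinearMap.mkContinuous
    { toFun := fun x => ∫ r in (0 : ℝ)..e, T r x
      map_add' := fun x y => ?_
      map_smul' := hsmul } (C * e) fun x => ?_, fun x => rfl⟩
  · simp_rw [_root_.map_add]
    exact intervalIntegral.integral_add (hT.intervalIntegrable_orbit x le_rfl he)
      (hT.intervalIntegrable_orbit y le_rfl he)
  · refine (norm_integral_orbit_le he hC x).trans (le_of_eq ?_)
    ring

/-- The adjoint of a strongly continuous semigroup on a Hilbert space is strongly continuous. The
vectors of strong continuity form a closed subspace that contains the ranges of the adjoints of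
the integrated semigroup, and only `0` is orthogonal to all of these. -/
theorem IsC0Semigroup.tendsto_adjoint {T : ℝ → H →L[𝕜] H} (hT : IsC0Semigroup T) (v : H) :
    Tendsto (fun h : ℝ => adjoint (T h) v - v) (𝓝[>] 0) (𝓝 0) := by
  obtain ⟨C, hC0, hC⟩ := hT.exists_bound 1
  have hev : ∀ᶠ h : ℝ in 𝓝[>] 0, h ∈ Ioo (0 : ℝ) 1 := Ioo_mem_nhdsGT one_pos
  -- the subspace of vectors on which the adjoint semigroup is strongly continuous at `0`
  let Y : Submodule 𝕜 H :=
    { carrier := {v | Tendsto (fun h : ℝ => adjoint (T h) v - v) (𝓝[>] 0) (𝓝 0)}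
      zero_mem' := by simp
      add_mem' := fun {a b} ha hb => by
        have := Tendsto.add ha hb
        rw [add_zero] at this
        refine this.congr fun h => ?_
        rw [_root_.map_add]
        abel
      smul_mem' := fun c a ha => by
        have := Tendsto.const_smul ha c
        rw [smul_zero] at this
        refine this.congr fun h => ?_
        rw [map_smul, smul_sub] }
  have hYdef : ∀ w, w ∈ Y ↔ Tendsto (fun h : ℝ => adjoint (T h) w - w) (𝓝[>] 0) (𝓝 0) :=
    fun w => Iff.rfl
  have hmem : ∀ (e : ℝ), 0 ≤ e → ∀ P : H →L[𝕜] H, (∀ x, P x = ∫ r in (0 : ℝ)..e, T r x) →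
      ∀ w, adjoint P w ∈ Y := by
    intro e he P hP w
    obtain ⟨D, hD0, hD⟩ := hT.exists_bound (e + 1)
    rw [hYdef]
    have hsq : Tendsto (fun h : ℝ => (2 * D * ‖w‖) * h) (𝓝[>] 0) (𝓝 0) := by
      have : Continuous fun h : ℝ => (2 * D * ‖w‖) * h := by fun_prop
      simpa using (this.tendsto 0).mono_left nhdsWithin_le_nhds
    refine squeeze_zero_norm' ?_ hsq
    filter_upwards [hev] with h hh
    have hPT : adjoint (T h) (adjoint P w) - adjoint P w = adjoint (P ∘L T h - P) w := by
      rw [map_sub, ContinuousLinearMap.adjoint_comp]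
      rfl
    rw [hPT]
    -- `P (T(h) x) - P x` is an integral over `[e, e + h]` minus one over `[0, h]`
    have hn : ‖P ∘L T h - P‖ ≤ 2 * D * h := by
      refine ContinuousLinearMap.opNorm_le_bound _ (by have := hh.1; positivity) fun x => ?_
      have h1 : (P ∘L T h - P) x = T h (P x) - P x := by
        have : ∀ r ∈ uIcc (0 : ℝ) e, T r (T h x) = T h (T r x) := by
          intro r hr
          rw [uIcc_of_le he] at hr
          rw [← hT.apply_add hr.1 hh.1.le, ← hT.apply_add hh.1.le hr.1, add_comm]
        have h2 : P (T h x) = T h (P x) := by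
          rw [hP, hP, intervalIntegral.integral_congr this]
          exact ContinuousLinearMap.intervalIntegral_comp_comm _
            (hT.intervalIntegrable_orbit x le_rfl he)
        simp [h2]
      have hPx : T h (P x) - P x =
          (∫ r in e..(e + h), T r x) - ∫ r in (0 : ℝ)..h, T r x := by
        rw [hP, hT.apply_integral_orbit x he hh.1.le, ← intervalIntegral.integral_interval_sub_left
          (hT.intervalIntegrable_orbit x le_rfl (add_nonneg he hh.1.le))
          (hT.intervalIntegrable_orbit x le_rfl he)]
        abel
      rw [h1, hPx]
      have e1 : ‖∫ r in e..(e + h), T r x‖ ≤ D * ‖x‖ * |e + h - e| := by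
        refine intervalIntegral.norm_integral_le_of_norm_le_const fun r hr => ?_
        rw [uIoc_of_le (by linarith [hh.1])] at hr
        exact (T r).le_of_opNorm_le (hD r ⟨he.trans hr.1.le, by linarith [hr.2, hh.2]⟩) x
      rw [add_sub_cancel_left, abs_of_pos hh.1] at e1
      have e2 := norm_integral_orbit_le (T := T) (C := D) hh.1.le
        (fun t ht => hD t ⟨ht.1, by linarith [ht.2, hh.2]⟩) x
      calc _ ≤ _ := norm_sub_le _ _
        _ ≤ D * ‖x‖ * h + D * ‖x‖ * h := add_le_add e1 e2
        _ = 2 * D * h * ‖x‖ := by ring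
    refine ((adjoint (P ∘L T h - P)).le_opNorm w).trans ?_
    rw [LinearIsometryEquiv.norm_map]
    calc _ ≤ 2 * D * h * ‖w‖ := by gcongr
      _ = _ := by ring
  have hclosed : Y.topologicalClosure ≤ Y := by
    intro w hw
    rw [hYdef, Metric.tendsto_nhds]
    intro ε hε
    have hw' : w ∈ closure (Y : Set H) := hw
    obtain ⟨w', hw'Y, hd⟩ := Metric.mem_closure_iff.1 hw' (ε / (2 * (C + 1))) (by positivity)
    have h2 := (Metric.tendsto_nhds.1 ((hYdef w').1 hw'Y)) (ε / 2) (by positivity)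
    filter_upwards [h2, hev] with h hh hh'
    rw [dist_zero_right] at hh ⊢
    rw [dist_eq_norm, lt_div_iff₀ (by positivity)] at hd
    have hsplit : adjoint (T h) w - w =
        adjoint (T h) (w - w') - (w - w') + (adjoint (T h) w' - w') := by
      rw [map_sub]; abel
    have h3 : ‖adjoint (T h) (w - w')‖ ≤ C * ‖w - w'‖ := by
      refine ContinuousLinearMap.le_of_opNorm_le _ ?_ _
      rw [LinearIsometryEquiv.norm_map]
      exact hC h ⟨hh'.1.le, hh'.2.le⟩
    rw [hsplit]
    have h4 := norm_add_le (adjoint (T h) (w - w') - (w - w')) (adjoint (T h) w' - w')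
    have h5 := norm_sub_le (adjoint (T h) (w - w')) (w - w')
    nlinarith
  have hperp : Yᗮ = ⊥ := by
    rw [Submodule.eq_bot_iff]
    intro x hx
    refine tendsto_nhds_unique (hT.tendsto_slope_integral_orbit_zero x) ?_
    refine tendsto_const_nhds.congr' ?_
    filter_upwards [self_mem_nhdsWithin] with e he
    obtain ⟨P, hP⟩ := hT.exists_integral_clm (le_of_lt he)
    have h1 := (Submodule.mem_orthogonal _ _).1 hx _ (hmem e (le_of_lt he) P hP (P x))
    rw [ContinuousLinearMap.adjoint_inner_left, inner_self_eq_zero, hP] at h1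
    rw [h1, smul_zero]
  have htop : Y.topologicalClosure = ⊤ := Submodule.topologicalClosure_eq_top_iff.2 hperp
  exact hclosed (htop ▸ Submodule.mem_top)

/-- Composed with a compact operator, the semigroup is continuous in operator norm at `0`: the
adjoint converges strongly, and the images of the unit ball lie in a compact set, where finitely
many functionals control the norm. -/
theorem IsC0Semigroup.eventually_norm_compact_comp_le {T : ℝ → H →L[𝕜] H} (hT : IsC0Semigroup T)
    {F : H →L[𝕜] U} (hF : IsCompactOperator F) {ε : ℝ} (hε : 0 < ε) :
    ∀ᶠ h : ℝ in 𝓝[>] 0, ∀ x, ‖F (T h x - x)‖ ≤ ε * ‖x‖ := by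
  obtain ⟨C, hC0, hC⟩ := hT.exists_bound 1
  have hK := hF.isCompact_closure_image_closedBall (C + 1)
  -- cover the image of the ball by balls around finitely many `w`; each `w` is tested against
  -- `F (T h x - x)` through the adjoint
  obtain ⟨I, hIsub, hIfin, hI⟩ := hK.finite_cover_balls (show (0 : ℝ) < ε / 2 by positivity)
  have hfin : ∀ᶠ h : ℝ in 𝓝[>] 0,
      ∀ w ∈ I, ‖adjoint (T h) (adjoint F w) - adjoint F w‖ < ε ^ 2 / 2 := by
    rw [Filter.eventually_all_finite hIfin]
    intro w _
    have := Metric.tendsto_nhds.1 (hT.tendsto_adjoint (adjoint F w)) (ε ^ 2 / 2) (by positivity)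
    simpa [dist_zero_right] using this
  filter_upwards [hfin, Ioo_mem_nhdsGT one_pos] with h hh hh1
  have hball : ∀ x : H, ‖x‖ ≤ 1 → ‖F (T h x - x)‖ ≤ ε := by
    intro x hx
    set y := T h x - x with hy
    have hyn : ‖y‖ ≤ C + 1 := by
      have h1 := (T h).le_of_opNorm_le (hC h ⟨hh1.1.le, hh1.2.le⟩) x
      have h2 := norm_sub_le (T h x) x
      nlinarith [norm_nonneg x]
    have hmem : F y ∈ closure (F '' Metric.closedBall 0 (C + 1)) :=
      subset_closure ⟨y, by simpa using hyn, rfl⟩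
    obtain ⟨w, hw, hwb⟩ := mem_iUnion₂.1 (hI hmem)
    have hwb' : ‖F y - w‖ < ε / 2 := by simpa [dist_eq_norm] using hwb
    have h1 : inner 𝕜 (F y) (F y) = inner 𝕜 w (F y) + inner 𝕜 (F y - w) (F y) := by
      rw [← inner_add_left]; congr 1; abel
    have h2 : inner 𝕜 w (F y) = inner 𝕜 (adjoint (T h) (adjoint F w) - adjoint F w) x := by
      rw [inner_sub_left, ContinuousLinearMap.adjoint_inner_left,
        ContinuousLinearMap.adjoint_inner_left, ContinuousLinearMap.adjoint_inner_left,
        ← inner_sub_right, ← map_sub]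
    have h3 : ‖inner 𝕜 w (F y)‖ ≤ ε ^ 2 / 2 := by
      rw [h2]
      refine (norm_inner_le_norm _ _).trans ?_
      have := (hh w hw).le
      calc _ ≤ ‖adjoint (T h) (adjoint F w) - adjoint F w‖ * 1 := by gcongr
        _ ≤ _ := by linarith
    have h4 : ‖inner 𝕜 (F y - w) (F y)‖ ≤ ε / 2 * ‖F y‖ :=
      (norm_inner_le_norm _ _).trans (by gcongr)
    have h5 : ‖F y‖ ^ 2 ≤ ε ^ 2 / 2 + ε / 2 * ‖F y‖ := by
      have h6 : ‖inner 𝕜 (F y) (F y)‖ = ‖F y‖ ^ 2 := by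
        rw [inner_self_eq_norm_sq_to_K]; simp
      rw [← h6, h1]
      exact (norm_add_le _ _).trans (add_le_add h3 h4)
    by_contra hlt
    nlinarith [not_le.1 hlt]
  intro x
  rcases eq_or_ne x 0 with rfl | hx
  · simp
  have hn : ‖x‖ ≠ 0 := norm_ne_zero_iff.2 hx
  have := hball (((‖x‖⁻¹ : ℝ) : 𝕜) • x) (by rw [norm_smul]; simp [hn])
  rw [map_smul, ← smul_sub, map_smul, norm_smul] at this
  simp only [RCLike.norm_ofReal, abs_inv, abs_norm] at this
  rwa [inv_mul_le_iff₀ (by positivity), mul_comm] at this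

end Compactness

section SampledData

variable {𝕜 : Type*} [RCLike 𝕜]
  {H : Type*} [NormedAddCommGroup H] [InnerProductSpace 𝕜 H] [NormedSpace ℝ H]
  [IsScalarTower ℝ 𝕜 H] [CompleteSpace H]
  {U : Type*} [NormedAddCommGroup U] [InnerProductSpace 𝕜 U] [CompleteSpace U]

/-! ### Exponential stability under sampled-data control -/

/-- The state at time `s` after an update at the state `z`, the control being held at `F z`. -/
noncomputable def heldFlow (T : ℝ → H →L[𝕜] H) (B : U →L[𝕜] H) (f : U → U) (F : H →L[𝕜] U)
    (z : H) (s : ℝ) : H :=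
  affineFlow T (B (f (F z))) z s

variable {T S : ℝ → H →L[𝕜] H} {B : U →L[𝕜] H} {f : U → U} {F : H →L[𝕜] U}

/-- While the control is held for a short time, the deviation of the input from the linear feedback
is barely larger than the sector bound `θ` allows; the compactness of `F` enters here. -/
theorem exists_input_deviation_le (hT : IsC0Semigroup T) (hF : IsCompactOperator F) {θ : ℝ}
    (hθ : 0 < θ) (hsector : ∀ x : H, ‖f (F x) - F x‖ ≤ θ * ‖x‖) {η : ℝ} (hη : 0 < η) :
    ∃ τs, 0 < τs ∧ ∀ s, 0 ≤ s → s < τs → ∀ z : H,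
      ‖B (f (F z)) - B (F (heldFlow T B f F z s))‖ ≤ ‖B‖ * (θ + η) * ‖z‖ := by
  obtain ⟨C, hC0, hC⟩ := hT.exists_bound 1
  obtain ⟨τ₁, hτ₁, h₁⟩ := mem_nhdsGT_iff_exists_Ioo_subset.1
    (hT.eventually_norm_compact_comp_le hF (half_pos hη))
  have hτ₁' : (0 : ℝ) < τ₁ := hτ₁
  have hfz : ∀ z, ‖f (F z)‖ ≤ (‖F‖ + θ) * ‖z‖ := fun z => by
    have h1 := norm_add_le (f (F z) - F z) (F z)
    rw [sub_add_cancel] at h1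
    linarith [hsector z, F.le_opNorm z]
  set D := ‖F‖ * (C * (‖B‖ * (‖F‖ + θ))) with hD
  have hD0 : 0 ≤ D := by positivity
  refine ⟨min (min τ₁ 1) (η / 2 / (D + 1)), by positivity, fun s hs hlt z => ?_⟩
  have hs1 : s < τ₁ := hlt.trans_le ((min_le_left _ _).trans (min_le_left _ _))
  have hs2 : s ≤ 1 := (hlt.trans_le ((min_le_left _ _).trans (min_le_right _ _))).le
  have hs3 : s ≤ η / 2 / (D + 1) := (hlt.trans_le (min_le_right _ _)).le
  rw [le_div_iff₀ (by positivity)] at hs3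
  have hsplit : B (f (F z)) - B (F (heldFlow T B f F z s)) = B ((f (F z) - F z) -
      F (T s z - z) - F (∫ r in (0 : ℝ)..s, T r (B (f (F z))))) := by
    simp only [heldFlow, affineFlow, map_sub, _root_.map_add]
    abel
  have h2 : ‖F (T s z - z)‖ ≤ η / 2 * ‖z‖ := by
    rcases hs.eq_or_lt with rfl | hs0
    · rw [hT.apply_zero]
      simp only [sub_self, map_zero, norm_zero]
      positivity
    · exact h₁ ⟨hs0, hs1⟩ z
  have h3 : ‖F (∫ r in (0 : ℝ)..s, T r (B (f (F z))))‖ ≤ η / 2 * ‖z‖ := by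
    have e1 := IsC0Semigroup.norm_integral_orbit_le (T := T) (C := C) hs
      (fun t ht => hC t ⟨ht.1, ht.2.trans hs2⟩) (B (f (F z)))
    have e2 : ‖B (f (F z))‖ ≤ ‖B‖ * ((‖F‖ + θ) * ‖z‖) :=
      (B.le_opNorm _).trans (by gcongr; exact hfz z)
    calc _ ≤ ‖F‖ * (C * (‖B‖ * ((‖F‖ + θ) * ‖z‖)) * s) :=
          (F.le_opNorm _).trans (by gcongr; exact e1.trans (by gcongr))
      _ = D * s * ‖z‖ := by rw [hD]; ring
      _ ≤ _ := by gcongr; linarith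
  rw [hsplit, mul_assoc]
  refine (B.le_opNorm _).trans (mul_le_mul_of_nonneg_left ?_ (norm_nonneg _))
  have h4 := norm_sub_le ((f (F z) - F z) - F (T s z - z))
    (F (∫ r in (0 : ℝ)..s, T r (B (f (F z)))))
  have h5 := norm_sub_le (f (F z) - F z) (F (T s z - z))
  linarith [hsector z]

theorem integral_exp_decay {ξ : ℝ} (hξ : 0 < ξ) (r τ : ℝ) :
    ∫ s in (0 : ℝ)..τ, Real.exp (-ξ * (r + (τ - s))) =
      Real.exp (-ξ * r) * (1 - Real.exp (-ξ * τ)) / ξ := by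
  have hd : ∀ s ∈ uIcc 0 τ, HasDerivAt (fun s => Real.exp (-ξ * (r + (τ - s))) / ξ)
      (Real.exp (-ξ * (r + (τ - s)))) s := by
    intro s _
    have h1 : HasDerivAt (fun s => -ξ * (r + (τ - s))) ξ s := by
      have := (((hasDerivAt_id s).const_sub τ).const_add r).const_mul (-ξ)
      simpa using this
    have := h1.exp.div_const ξ
    rwa [mul_div_assoc, div_self hξ.ne', mul_one] at this
  rw [intervalIntegral.integral_eq_sub_of_hasDerivAt hd
    ((by fun_prop : Continuous fun s => Real.exp (-ξ * (r + (τ - s)))).intervalIntegrable _ _)]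
  rw [sub_self, add_zero, sub_zero, mul_add, Real.exp_add]
  ring

/-- One sampling period contracts the weighted bound on `S(r) z` by a factor depending on the size
`q` of the input deviation relative to the decay rate `ξ`. Bounding all `S(r) z` at once amounts to
an equivalent norm for which `S` is contractive. -/
theorem norm_apply_heldFlow_le (hT : IsC0Semigroup T) (hS : IsC0Semigroup S)
    (hgen : ∀ x y, HasGeneratorValue T x y → HasGeneratorValue S x (y + B.comp F x))
    {N ξ : ℝ} (hN : 0 ≤ N) (hξ : 0 < ξ)
    (hSbound : ∀ t : ℝ, 0 ≤ t → ‖S t‖ ≤ N * Real.exp (-ξ * t)) {τ q c : ℝ} (hτ : 0 ≤ τ)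
    (hc : 0 ≤ c) (hcq : N * c = q * ξ) {z : H}
    (hdev : ∀ s ∈ Icc 0 τ, ‖B (f (F z)) - B (F (heldFlow T B f F z s))‖ ≤ c * ‖z‖) {R : ℝ}
    (hz : ∀ r, 0 ≤ r → ‖S r z‖ ≤ N * Real.exp (-ξ * r) * R) {r : ℝ} (hr : 0 ≤ r) :
    ‖S r (heldFlow T B f F z τ)‖ ≤ N * Real.exp (-ξ * r) *
      ((Real.exp (-ξ * τ) + q * (1 - Real.exp (-ξ * τ))) * R) := by
  set g : ℝ → H := fun s => B (f (F z)) - B.comp F (heldFlow T B f F z s) with hgdef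
  have hR : ‖z‖ ≤ N * R := by
    have := hz 0 le_rfl
    simpa [hS.apply_zero] using this
  have hgc : ContinuousOn g (Icc 0 τ) := continuousOn_const.sub
    ((B.comp F).continuous.comp_continuousOn
      ((hT.continuousOn_affineFlow _ z).mono fun s hs => hs.1))
  have hgi : IntervalIntegrable g volume 0 τ := by
    refine ContinuousOn.intervalIntegrable ?_
    rwa [uIcc_of_le hτ]
  have hvar : heldFlow T B f F z τ = S τ z + ∫ s in (0 : ℝ)..τ, S (τ - s) (g s) :=
    hT.affineFlow_eq_perturbed hS (B.comp F) hgen _ z hτ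
  rw [hvar, _root_.map_add, ← hS.apply_add hr hτ, ← ContinuousLinearMap.intervalIntegral_comp_comm _
    (hS.intervalIntegrable_convolution hτ le_rfl hgi)]
  have hint : ‖∫ s in (0 : ℝ)..τ, S r (S (τ - s) (g s))‖ ≤
      ∫ s in (0 : ℝ)..τ, N * (c * ‖z‖) * Real.exp (-ξ * (r + (τ - s))) := by
    refine intervalIntegral.norm_integral_le_of_norm_le hτ (ae_of_all _ fun s hs => ?_)
      ((by fun_prop : Continuous fun s =>
        N * (c * ‖z‖) * Real.exp (-ξ * (r + (τ - s)))).intervalIntegrable _ _)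
    have hs' : 0 ≤ τ - s := sub_nonneg.2 hs.2
    rw [← hS.apply_add hr hs']
    calc _ ≤ N * Real.exp (-ξ * (r + (τ - s))) * (c * ‖z‖) :=
          ((S _).le_of_opNorm_le (hSbound _ (add_nonneg hr hs')) _).trans
            (by gcongr; exact hdev s ⟨hs.1.le, hs.2⟩)
      _ = _ := by ring
  rw [intervalIntegral.integral_const_mul, integral_exp_decay hξ] at hint
  have h1 := hz (r + τ) (add_nonneg hr hτ)
  have hexp : Real.exp (-ξ * (r + τ)) = Real.exp (-ξ * r) * Real.exp (-ξ * τ) := by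
    rw [mul_add, Real.exp_add]
  rw [hexp] at h1
  have he1 : 0 ≤ 1 - Real.exp (-ξ * τ) := by
    rw [sub_nonneg, Real.exp_le_one_iff]
    nlinarith
  have h2 : N * (c * ‖z‖) * (Real.exp (-ξ * r) * (1 - Real.exp (-ξ * τ)) / ξ) ≤
      q * (N * R) * (Real.exp (-ξ * r) * (1 - Real.exp (-ξ * τ))) := by
    have hq : 0 ≤ q := by
      by_contra hlt
      nlinarith [mul_nonneg hN hc]
    have : N * (c * ‖z‖) * (Real.exp (-ξ * r) * (1 - Real.exp (-ξ * τ)) / ξ) =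
        q * ‖z‖ * (Real.exp (-ξ * r) * (1 - Real.exp (-ξ * τ))) := by
      rw [← mul_assoc N, hcq]
      field_simp
    rw [this]
    have := Real.exp_pos (-ξ * r)
    gcongr
  refine (norm_add_le _ _).trans ((add_le_add h1 (hint.trans h2)).trans (le_of_eq ?_))
  ring

/-- Sampled-data control is exponentially stabilizing for every small enough sampling period. -/
theorem exists_sampledDataExpStable (hT : IsC0Semigroup T) (hS : IsC0Semigroup S)
    (hF : IsCompactOperator F)
    (hgen : ∀ x y, HasGeneratorValue T x y → HasGeneratorValue S x (y + B.comp F x))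
    {N ξ : ℝ} (hN : 1 ≤ N) (hξ : 0 < ξ)
    (hSbound : ∀ t : ℝ, 0 ≤ t → ‖S t‖ ≤ N * Real.exp (-ξ * t)) {θ : ℝ} (hθ : 0 < θ)
    (hsector : ∀ x : H, ‖f (F x) - F x‖ ≤ θ * ‖x‖) (hsmall : θ * (N * ‖B‖) < ξ) :
    ∃ τs : ℝ, 0 < τs ∧ ∀ τ : ℝ, 0 < τ → τ < τs →
      ∃ G χ : ℝ, 1 ≤ G ∧ 0 < χ ∧ SampledDataExpStable T B f F τ G χ := by
  have hN0 : 0 < N := by linarith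
  obtain ⟨η, hη, hηs⟩ : ∃ η, 0 < η ∧ N * (‖B‖ * (θ + η)) < ξ := by
    have hpos : 0 < N * ‖B‖ + 1 := by positivity
    refine ⟨(ξ - θ * (N * ‖B‖)) / (N * ‖B‖ + 1), div_pos (by linarith) hpos, ?_⟩
    have h1 : (N * ‖B‖ + 1) * ((ξ - θ * (N * ‖B‖)) / (N * ‖B‖ + 1)) = ξ - θ * (N * ‖B‖) :=
      mul_div_cancel₀ _ hpos.ne'
    have h2 := div_pos (sub_pos.2 hsmall) hpos
    nlinarith
  obtain ⟨τs, hτs, hdev⟩ := exists_input_deviation_le (B := B) hT hF hθ hsector hη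
  refine ⟨τs, hτs, fun τ hτ hττs => ?_⟩
  set c := ‖B‖ * (θ + η) with hc
  have hc0 : 0 ≤ c := by positivity
  set q := N * c / ξ with hq
  have hq0 : 0 ≤ q := by positivity
  have hq1 : q < 1 := (div_lt_one hξ).2 hηs
  have hcq : N * c = q * ξ := (div_mul_cancel₀ _ hξ.ne').symm
  have hE0 := Real.exp_pos (-ξ * τ)
  have hE1 : Real.exp (-ξ * τ) < 1 := by rw [Real.exp_lt_one_iff]; nlinarith
  -- the contraction factor per period: a convex combination of `1` and `q`
  set ρ := Real.exp (-ξ * τ) + q * (1 - Real.exp (-ξ * τ)) with hρ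
  have hρ0 : 0 < ρ := by nlinarith
  have hρ1 : ρ < 1 := by nlinarith
  have hlog : Real.log ρ < 0 := Real.log_neg hρ0 hρ1
  obtain ⟨C, hC0, hC⟩ := hT.exists_bound τ
  set D := C + C * (‖B‖ * (‖F‖ + θ)) * τ with hD
  have hD0 : 0 ≤ D := by positivity
  -- `D` bounds the growth within one period; the division by `ρ` pays for the last, incomplete
  -- period
  refine ⟨max 1 (D * N / ρ), -Real.log ρ / τ, le_max_left _ _, div_pos (by linarith) hτ, ?_⟩
  intro x₀ u x hu hx t ht
  have hstep : ∀ (k : ℕ) (s : ℝ), 0 ≤ s → s ≤ τ →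
      x (k * τ + s) = heldFlow T B f F (x (k * τ)) s := by
    intro k s hs hsτ
    have h1 := hT.eq_affineFlow_of_const hx (a := k * τ) (s := k * τ + s) (by positivity)
      (by linarith) (b := B (f (F (x (k * τ))))) (fun r hr => by
        rw [hu k r ⟨hr.1, by nlinarith [hr.2]⟩])
    rwa [add_sub_cancel_left] at h1
  have hx0 : x 0 = x₀ := by
    have := hx.eq 0 le_rfl
    simpa [hT.apply_zero] using this
  have hind : ∀ (k : ℕ) (r : ℝ), 0 ≤ r →
      ‖S r (x (k * τ))‖ ≤ N * Real.exp (-ξ * r) * (ρ ^ k * ‖x₀‖) := by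
    intro k
    induction k with
    | zero =>
      intro r hr
      simpa [hx0] using (S r).le_of_opNorm_le (hSbound r hr) x₀
    | succ k ih =>
      intro r hr
      have h1 : x (((k + 1 : ℕ) : ℝ) * τ) = heldFlow T B f F (x (k * τ)) τ := by
        rw [← hstep k τ hτ.le le_rfl]
        congr 1
        push_cast
        ring
      rw [h1]
      refine (norm_apply_heldFlow_le hT hS hgen hN0.le hξ hSbound hτ.le hc0 hcq
        (fun s hs => hdev s hs.1 (hs.2.trans_lt hττs) _) ih hr).trans (le_of_eq ?_)
      rw [← hρ, pow_succ]
      ring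
  obtain ⟨k, s, hs, hsτ, hts⟩ : ∃ (k : ℕ) (s : ℝ), 0 ≤ s ∧ s ≤ τ ∧ t = k * τ + s := by
    refine ⟨⌊t / τ⌋₊, t - ⌊t / τ⌋₊ * τ, ?_, ?_, by ring⟩
    · have := Nat.floor_le (div_nonneg ht hτ.le)
      rw [le_div_iff₀ hτ] at this
      linarith
    · have := Nat.lt_floor_add_one (t / τ)
      rw [div_lt_iff₀ hτ] at this
      linarith
  have hxk : ‖x (k * τ)‖ ≤ N * (ρ ^ k * ‖x₀‖) := by
    simpa [hS.apply_zero] using hind k 0 le_rfl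
  have hfl : ‖x t‖ ≤ D * ‖x (k * τ)‖ := by
    rw [hts, hstep k s hs hsτ]
    have e1 := IsC0Semigroup.norm_affineFlow_le (T := T) hs (fun r hr => hC r ⟨hr.1, hr.2.trans hsτ⟩)
      (B (f (F (x (k * τ))))) (x (k * τ))
    have e2 : ‖B (f (F (x (k * τ))))‖ ≤ ‖B‖ * ((‖F‖ + θ) * ‖x (k * τ)‖) := by
      refine (B.le_opNorm _).trans ?_
      gcongr
      have h1 := norm_add_le (f (F (x (k * τ))) - F (x (k * τ))) (F (x (k * τ)))
      rw [sub_add_cancel] at h1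
      linarith [hsector (x (k * τ)), F.le_opNorm (x (k * τ))]
    calc _ ≤ C * ‖x (k * τ)‖ + C * (‖B‖ * ((‖F‖ + θ) * ‖x (k * τ)‖)) * τ :=
          e1.trans (by gcongr)
      _ = D * ‖x (k * τ)‖ := by rw [hD]; ring
  have hpow : ρ ^ k ≤ ρ⁻¹ * Real.exp (-(-Real.log ρ / τ) * t) := by
    have h1 : ρ ^ k = Real.exp (Real.log ρ * k) := by
      rw [mul_comm, Real.exp_nat_mul, Real.exp_log hρ0]
    have h2 : ρ⁻¹ = Real.exp (-Real.log ρ) := by rw [Real.exp_neg, Real.exp_log hρ0]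
    rw [h1, h2, ← Real.exp_add, Real.exp_le_exp]
    have h3 : -(-Real.log ρ / τ) * t = Real.log ρ * (t / τ) := by ring
    have h4 : t / τ ≤ k + 1 := by
      rw [div_le_iff₀ hτ, hts]
      linarith
    rw [h3]
    nlinarith
  calc ‖x t‖ ≤ D * (N * ((ρ⁻¹ * Real.exp (-(-Real.log ρ / τ) * t)) * ‖x₀‖)) :=
        hfl.trans (by gcongr; exact hxk.trans (by gcongr))
    _ = D * N / ρ * Real.exp (-(-Real.log ρ / τ) * t) * ‖x₀‖ := by ring
    _ ≤ _ := by gcongr; exact le_max_right _ _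

end SampledData

section Comparison

/-! ### Comparison on a bounded interval -/

theorem upperRightDini_congr {y y' : ℝ → ℝ} {t : ℝ} (ht : y t = y' t) (h : y =ᶠ[𝓝[>] t] y') :
    upperRightDini y t = upperRightDini y' t := by
  have hmap : Tendsto (fun h : ℝ => t + h) (𝓝[>] 0) (𝓝[>] t) := by
    refine tendsto_nhdsWithin_iff.2 ⟨?_, ?_⟩
    · have : Continuous (fun h : ℝ => t + h) := by fun_prop
      simpa using (this.tendsto 0).mono_left nhdsWithin_le_nhds
    · filter_upwards [self_mem_nhdsWithin] with h hh
      exact lt_add_of_pos_right t hh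
  refine limsup_congr ?_
  filter_upwards [hmap.eventually h] with h hh
  rw [hh, ht]

theorem upperRightDini_comp_const_add (y : ℝ → ℝ) (a t : ℝ) :
    upperRightDini (fun s => y (a + s)) t = upperRightDini y (a + t) := by
  simp only [upperRightDini, add_assoc]

/-- A bound from the comparison principle also serves a function that satisfies the differential
inequality on a bounded interval only: beyond the interval, the function is continued by letting
it decrease linearly to `0`, at the rate prescribed at the end of the interval. -/
theorem IsComparisonBound.le_of_bounded_interval {σ : ℝ} {α : ℝ≥0 → ℝ≥0} {κ : ℝ≥0 → ℝ≥0 → ℝ≥0}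
    (hκ : IsComparisonBound σ α κ) (hσ : σ < 1) (hα : Monotone α) (hα0 : α 0 = 0) {y : ℝ → ℝ≥0}
    {l : ℝ≥0} (hy : ContinuousOn y (Icc 0 l))
    (hD : ∀ t : ℝ, 0 ≤ t → t < l →
      upperRightDini (fun s => (y s : ℝ)) t ≤ ((-(1 - σ) * (α (y t) : ℝ) : ℝ) : EReal)) :
    y l ≤ κ (y 0) l := by
  set m : ℝ := (1 - σ) * α (y l) with hm
  have hm0 : 0 ≤ m := mul_nonneg (by linarith) (α (y l)).2
  -- truncated subtraction in `ℝ≥0` stops the linear decrease at `0`, and `toNNReal` makes the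
  -- correction vanish before `l`
  let Y : ℝ → ℝ≥0 := fun s => y (min s l) - Real.toNNReal (m * (s - l))
  have hleft : ∀ s : ℝ, s ≤ l → Y s = y s := fun s hs => by
    have : Real.toNNReal (m * (s - l)) = 0 := Real.toNNReal_of_nonpos (by nlinarith)
    simp only [Y, min_eq_left hs, this, tsub_zero]
  have hright : ∀ s : ℝ, l ≤ s → (Y s : ℝ) = max (y l - m * (s - l)) 0 := fun s hs => by
    simp only [Y, min_eq_right hs, NNReal.coe_sub_def]
    rw [Real.coe_toNNReal _ (mul_nonneg hm0 (sub_nonneg.2 hs))]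
  have hYc : ContinuousOn Y (Ici 0) := by
    refine ContinuousOn.sub (hy.comp (by fun_prop) fun s hs => ?_)
      (Continuous.continuousOn (by fun_prop))
    exact ⟨le_min hs l.2, min_le_right _ _⟩
  have h := hκ Y hYc (fun t ht => ?_) l
  · rwa [hleft l le_rfl, hleft 0 l.2] at h
  rcases lt_or_ge t l with htl | htl
  · rw [hleft t htl.le]
    refine le_of_eq_of_le (upperRightDini_congr (by rw [hleft t htl.le]) ?_) (hD t ht htl)
    filter_upwards [Ioo_mem_nhdsGT htl] with s hs
    rw [hleft s hs.2.le]
  · refine limsup_le_of_le (h := ?_)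
    rcases le_or_gt ((y l : ℝ) - m * (t - l)) 0 with hp | hp
    · have hYt : Y t = 0 := by
        have := hright t htl
        rw [max_eq_right hp] at this
        exact_mod_cast this
      filter_upwards [self_mem_nhdsWithin] with r hr
      have hr0 : (0 : ℝ) < r := hr
      have hYr : (Y (t + r) : ℝ) = 0 := by
        rw [hright _ (by linarith), max_eq_right (by nlinarith)]
      rw [hYr, hYt, hα0]
      simp
    · have hYt : (Y t : ℝ) = y l - m * (t - l) := by rw [hright t htl, max_eq_left hp.le]
      have hev : ∀ᶠ r : ℝ in 𝓝[>] 0, 0 < (y l : ℝ) - m * (t + r - l) := by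
        have hc : Continuous fun r : ℝ => (y l : ℝ) - m * (t + r - l) := by fun_prop
        refine ((hc.tendsto 0).mono_left nhdsWithin_le_nhds).eventually (lt_mem_nhds ?_)
        simpa using hp
      filter_upwards [hev, self_mem_nhdsWithin] with r hr hr0
      have hr0' : (0 : ℝ) < r := hr0
      rw [hright (t + r) (by linarith), max_eq_left hr.le, hYt, EReal.coe_le_coe_iff,
        div_le_iff₀ hr0']
      have hle : Y t ≤ y l := by
        rw [← NNReal.coe_le_coe, hYt]
        nlinarith
      have hαle : (1 - σ) * (α (Y t) : ℝ) ≤ m :=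
        mul_le_mul_of_nonneg_left (NNReal.coe_le_coe.2 (hα hle)) (by linarith)
      nlinarith

end Comparison

section Lyapunov

variable {𝕜 : Type*} [RCLike 𝕜]
  {H : Type*} [NormedAddCommGroup H] [InnerProductSpace 𝕜 H] [NormedSpace ℝ H]
  [IsScalarTower ℝ 𝕜 H] [CompleteSpace H]
  {U : Type*} [NormedAddCommGroup U] [InnerProductSpace 𝕜 U] [CompleteSpace U]
  {T : ℝ → H →L[𝕜] H} {B : U →L[𝕜] H} {f : U → U} {F : H →L[𝕜] U}
  {V : H → ℝ≥0} {ψ₁ ψ₂ α γ : ℝ≥0 → ℝ≥0}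

/-! ### Decay of the Lyapunov function while the control is held -/

/-- Dissipation along a held control. The error made by not updating the control plays the role
of the disturbance; it is locally Lipschitz because the state starts in the domain of the
generator. -/
theorem IsCoerciveISSLyapunov.upperRightDini_heldFlow_le
    (hV : IsCoerciveISSLyapunov T B f F V ψ₁ ψ₂ α γ) (hT : IsC0Semigroup T) {L : ℝ≥0}
    (hf : LipschitzWith L (fun x : H => f (F x))) {z y : H} (hz : HasGeneratorValue T z y)
    {t : ℝ} (ht : 0 ≤ t) :
    upperRightDini (fun s => (V (heldFlow T B f F z s) : ℝ)) t ≤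
      ((-(α (V (heldFlow T B f F z t)) : ℝ) +
        (γ ‖B (f (F z) - f (F (heldFlow T B f F z t)))‖₊ : ℝ) : ℝ) : EReal) := by
  set φ := heldFlow T B f F z with hφ
  set d : ℝ → H := fun s => B (f (F z) - f (F (φ (t + s)))) with hd
  have hshift : ∀ s, 0 ≤ s → φ (t + s) = affineFlow T (B (f (F z))) (φ t) s := fun s hs =>
    hT.affineFlow_add _ z ht hs
  have hdlip : LocallyLipschitzOn (Ici 0) d := by
    intro s hs
    obtain ⟨K, hK⟩ := hT.lipschitzOnWith_affineFlow (b := B (f (F z))) hz (t + (s + 1))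
    have h1 : LipschitzOnWith (K * 1) (fun r => φ (t + r)) (Icc 0 (s + 1)) :=
      hK.comp (LipschitzWith.of_dist_le_mul fun r r' => by simp).lipschitzOnWith
        (fun r hr => ⟨add_nonneg ht hr.1, by linarith [hr.2]⟩)
    have h2 : LipschitzOnWith (‖B‖₊ * (L * (K * 1))) d (Icc 0 (s + 1)) := by
      refine LipschitzOnWith.of_dist_le_mul fun r hr r' hr' => ?_
      have h3 := (hf.comp_lipschitzOnWith h1).dist_le_mul r hr r' hr'
      rw [dist_eq_norm, ← map_sub, sub_sub_sub_cancel_left, NNReal.coe_mul, mul_assoc]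
      refine (B.le_opNorm _).trans (mul_le_mul_of_nonneg_left ?_ (norm_nonneg B))
      rw [norm_sub_rev, ← dist_eq_norm]
      exact h3
    refine ⟨_, Icc 0 (s + 1), ?_, h2⟩
    filter_upwards [self_mem_nhdsWithin,
      mem_nhdsWithin_of_mem_nhds (Iio_mem_nhds (lt_add_one s))] with r hr hr'
    exact ⟨hr, le_of_lt hr'⟩
  have hmild : IsMildSolution T (fun s => B (f (F (φ (t + s)))) + d s) (φ t)
      (fun s => φ (t + s)) := by
    have h0 := hT.isMildSolution_affineFlow (B (f (F z))) (φ t)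
    have hin : (fun s => B (f (F (φ (t + s)))) + d s) = fun _ => B (f (F z)) := by
      funext s
      simp [hd]
    rw [hin]
    exact ⟨h0.integrable, h0.continuousOn.congr fun s hs => hshift s hs,
      fun s hs => (hshift s hs).trans (h0.eq s hs)⟩
  have h := hV.dissipation (φ t) d (fun s => φ (t + s)) hdlip hmild
  rw [upperRightDini_comp_const_add (fun s => (V (φ s) : ℝ)) t 0, add_zero] at h
  simpa [hd] using h

/-- While no event is triggered, `V` decays along a held control as the comparison principle
predicts. For initial states in the domain of the generator this follows from the dissipation
inequality; strict inequalities on a compact interval persist for nearby states, so density of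
the domain gives the general case. -/
theorem IsCoerciveISSLyapunov.heldFlow_le
    (hV : IsCoerciveISSLyapunov T B f F V ψ₁ ψ₂ α γ) (hT : IsC0Semigroup T) {L : ℝ≥0}
    (hf : LipschitzWith L (fun x : H => f (F x))) {σ : ℝ} (hσ : σ < 1)
    {κ : ℝ≥0 → ℝ≥0 → ℝ≥0} (hκ : IsClassKL κ) (hcomp : IsComparisonBound σ α κ)
    {z : H} {a : ℝ} (ha : 0 ≤ a) {l : ℝ≥0}
    (hz : ∀ s ∈ Icc a (a + l), (γ ‖B (f (F z) - f (F (heldFlow T B f F z s)))‖₊ : ℝ) <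
      σ * α (V (heldFlow T B f F z s))) :
    V (heldFlow T B f F z (a + l)) ≤ κ (V (heldFlow T B f F z a)) l := by
  have hcB : Continuous fun z : H => B (f (F z)) := B.continuous.comp hf.continuous
  have hflow : Continuous fun p : H × ℝ => heldFlow T B f F p.1 (max p.2 0) :=
    hT.continuous_affineFlow hcB
  have hflowz : ∀ s, 0 ≤ s → Continuous fun z : H => heldFlow T B f F z s := fun s hs => by
    have := hflow.comp (Continuous.prodMk_left s)
    simpa [Function.comp_def, max_eq_left hs] using this
  let W : H → ℝ → Prop := fun z s =>
    (γ ‖B (f (F z) - f (F (heldFlow T B f F z (max s 0))))‖₊ : ℝ) <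
      σ * α (V (heldFlow T B f F z (max s 0)))
  have hopen : IsOpen {p : H × ℝ | W p.1 p.2} := by
    refine isOpen_lt ?_ ?_
    · refine NNReal.continuous_coe.comp (hV.gamma.continuous.comp (continuous_nnnorm.comp
        (B.continuous.comp (Continuous.sub ?_ ?_))))
      · exact hf.continuous.comp continuous_fst
      · exact hf.continuous.comp hflow
    · exact continuous_const.mul (NNReal.continuous_coe.comp (hV.alpha.continuous.comp
        (hV.continuous.comp hflow)))
  -- by compactness, nearby initial states trigger no event on the whole interval either
  have hnear : ∀ᶠ z' in 𝓝 z, ∀ s ∈ Icc a (a + l), W z' s := by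
    refine isCompact_Icc.eventually_forall_of_forall_eventually fun s hs => ?_
    refine hopen.mem_nhds ?_
    simp only [W, mem_ofPred_eq, max_eq_left (ha.trans hs.1)]
    exact hz s hs
  have hclosed : IsClosed {z' : H | V (heldFlow T B f F z' (a + l)) ≤
      κ (V (heldFlow T B f F z' a)) l} := by
    refine isClosed_le (hV.continuous.comp (hflowz _ (add_nonneg ha l.2))) ?_
    exact hκ.continuous.comp ((hV.continuous.comp (hflowz a ha)).prodMk continuous_const)
  have hfreq : ∃ᶠ z' in 𝓝 z, z' ∈ {z' : H | V (heldFlow T B f F z' (a + l)) ≤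
      κ (V (heldFlow T B f F z' a)) l} := by
    refine ((mem_closure_iff_frequently.1 (hT.dense_generator z)).and_eventually hnear).mono ?_
    rintro z' ⟨⟨y, hy⟩, hW⟩
    have hD := hcomp.le_of_bounded_interval hσ hV.alpha.strictMono.monotone hV.alpha.map_zero
      (y := fun s => V (heldFlow T B f F z' (a + s))) (l := l) ?_ ?_
    · simpa using hD
    · refine hV.continuous.comp_continuousOn ?_
      exact (hT.continuousOn_affineFlow _ z').comp (by fun_prop)
        fun s hs => add_nonneg ha hs.1
    · intro t ht htl
      rw [upperRightDini_comp_const_add (fun s => (V (heldFlow T B f F z' s) : ℝ)) a t]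
      refine (hV.upperRightDini_heldFlow_le hT hf hy (add_nonneg ha ht)).trans ?_
      rw [EReal.coe_le_coe_iff]
      have := hW (a + t) ⟨by linarith, by linarith⟩
      simp only [W, max_eq_left (add_nonneg ha ht)] at this
      linarith
  exact hclosed.closure_subset (mem_closure_iff_frequently.2 hfreq)

/-- The same decay when no event is triggered before the final time, by continuity. -/
theorem IsCoerciveISSLyapunov.heldFlow_le_of_Ico
    (hV : IsCoerciveISSLyapunov T B f F V ψ₁ ψ₂ α γ) (hT : IsC0Semigroup T) {L : ℝ≥0}
    (hf : LipschitzWith L (fun x : H => f (F x))) {σ : ℝ} (hσ : σ < 1)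
    {κ : ℝ≥0 → ℝ≥0 → ℝ≥0} (hκ : IsClassKL κ) (hcomp : IsComparisonBound σ α κ)
    {z : H} {a : ℝ} (ha : 0 ≤ a) {l : ℝ≥0}
    (hz : ∀ s ∈ Ico a (a + l), (γ ‖B (f (F z) - f (F (heldFlow T B f F z s)))‖₊ : ℝ) <
      σ * α (V (heldFlow T B f F z s))) :
    V (heldFlow T B f F z (a + l)) ≤ κ (V (heldFlow T B f F z a)) l := by
  rcases eq_or_ne l 0 with rfl | hl
  · have := hcomp.le_of_bounded_interval hσ hV.alpha.strictMono.monotone hV.alpha.map_zero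
      (y := fun _ => V (heldFlow T B f F z a)) (l := 0) continuousOn_const
      (fun t ht ht' => absurd ht' (not_lt.2 ht))
    simpa using this
  have hl0 : (0 : ℝ) < l := by exact_mod_cast pos_iff_ne_zero.2 hl
  have hcl : closure (Ico (0 : ℝ) l) = Icc (0 : ℝ) l := closure_Ico hl0.ne
  have h := le_on_closure (s := Ico (0 : ℝ) l) (f := fun r => V (heldFlow T B f F z (a + r)))
    (g := fun r => κ (V (heldFlow T B f F z a)) r.toNNReal) (fun r hr => ?_) ?_ ?_
    (x := (l : ℝ)) (by rw [hcl]; exact ⟨hl0.le, le_rfl⟩)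
  · simpa using h
  · have := hV.heldFlow_le hT hf hσ hκ hcomp (z := z) ha (l := r.toNNReal) (fun s hs => hz s ?_)
    · rwa [Real.coe_toNNReal r hr.1] at this
    · rw [Real.coe_toNNReal r hr.1] at hs
      exact ⟨hs.1, by linarith [hs.2, hr.2]⟩
  · rw [hcl]
    refine hV.continuous.comp_continuousOn ?_
    exact (hT.continuousOn_affineFlow _ z).comp (by fun_prop)
      fun s hs => add_nonneg ha hs.1
  · exact (hκ.continuous.comp
      (continuous_const.prodMk continuous_real_toNNReal)).continuousOn

end Lyapunov

section ClosedLoop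

variable {𝕜 : Type*} [RCLike 𝕜]
  {H : Type*} [NormedAddCommGroup H] [InnerProductSpace 𝕜 H] [NormedSpace ℝ H]
  [IsScalarTower ℝ 𝕜 H] [CompleteSpace H]
  {U : Type*} [NormedAddCommGroup U] [InnerProductSpace 𝕜 U] [CompleteSpace U]
  {T : ℝ → H →L[𝕜] H} {B : U →L[𝕜] H} {f : U → U} {F : H →L[𝕜] U}
  {V : H → ℝ≥0} {ψ₁ ψ₂ α γ : ℝ≥0 → ℝ≥0}

/-! ### Solutions with piecewise constant control -/

/-- Held controls concatenate to a solution, once the states `z k` at the update times match. -/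
theorem exists_solution_of_states (hT : IsC0Semigroup T) (B : U →L[𝕜] H) (f : U → U)
    (F : H →L[𝕜] U) {t : ℕ → EReal} {τ : ℝ} (hτ : 0 < τ) (h0 : t 0 = 0)
    (hstep : ∀ k, t k + (τ : EReal) ≤ t (k + 1)) (z : ℕ → H)
    (hz : ∀ k, z (k + 1) = heldFlow T B f F (z k) ((t (k + 1)).toReal - (t k).toReal)) :
    ∃ (u : ℝ → U) (x : ℝ → H), IsMildSolution T (fun s => B (f (u s))) (z 0) x ∧
      (∀ (k : ℕ) (s : ℝ), t k ≤ (s : EReal) → (s : EReal) ≤ t (k + 1) →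
        x s = heldFlow T B f F (z k) (s - (t k).toReal)) ∧
      (∀ (k : ℕ) (s : ℝ), t k ≤ (s : EReal) → (s : EReal) < t (k + 1) →
        u s = F (x (t k).toReal)) ∧
      ∀ k, t k ≠ ⊤ → x (t k).toReal = z k := by
  have hmono : Monotone t :=
    monotone_nat_of_le_succ fun k => (le_add_of_real_step _ hτ).trans (hstep k)
  have hbot : ∀ k, t k ≠ ⊥ := fun k h => by
    have : 0 ≤ t k := h0 ▸ hmono (Nat.zero_le k)
    rw [h] at this; simp at this
  have hlt : ∀ k, t k ≠ ⊤ → t k < t (k + 1) := by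
    intro k hk
    refine lt_of_lt_of_le ?_ (hstep k)
    obtain ⟨a, ha⟩ : ∃ a : ℝ, t k = (a : EReal) := ⟨_, (EReal.coe_toReal hk (hbot k)).symm⟩
    rw [ha, ← EReal.coe_add, EReal.coe_lt_coe_iff]
    linarith
  obtain ⟨x, hx⟩ := exists_piecewise hmono
    (fun k s => heldFlow T B f F (z k) (s - (t k).toReal))
  obtain ⟨u, hu⟩ := exists_piecewise hmono (fun k _ => F (z k))
  have hxt : ∀ k, t k ≠ ⊤ → x (t k).toReal = z k := by
    intro k hk
    have hc := EReal.coe_toReal hk (hbot k)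
    rw [hx k _ hc.ge (hc.symm ▸ hlt k hk), sub_self]
    exact hT.affineFlow_zero _ _
  have hne : ∀ k (s : ℝ), t k ≤ (s : EReal) → t k ≠ ⊤ := fun k s hs h => by
    rw [h] at hs; exact absurd hs (not_le.2 (EReal.coe_lt_top s))
  have hx' : ∀ (k : ℕ) (s : ℝ), t k ≤ (s : EReal) → (s : EReal) ≤ t (k + 1) →
      x s = heldFlow T B f F (z k) (s - (t k).toReal) := by
    intro k s hs hs'
    rcases hs'.lt_or_eq with h | h
    · exact hx k s hs h
    · have hs2 : (t (k + 1)).toReal = s := by rw [← h, EReal.toReal_coe]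
      rw [← hs2, hxt (k + 1) (hne (k + 1) s h.ge), hz]
  refine ⟨u, x, ?_, hx', fun k s hs hs' => ?_, hxt⟩
  · have hz0 : x 0 = z 0 := by
      have := hxt 0 (by simp [h0])
      simpa [h0] using this
    rw [← hz0]
    refine hT.isMildSolution_of_pieces hτ h0 hstep (b := fun k => B (f (F (z k))))
      (fun k s hs hs' => by rw [hu k s hs hs']) fun k s hs hs' => ?_
    rw [hx' k s hs hs', hxt k (hne k s hs)]
    rfl
  · rw [hu k s hs hs', hxt k (hne k s hs)]

/-- Until the first sampling time the held control agrees with sampled-data control, so it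
inherits the exponential bound. -/
theorem SampledDataExpStable.norm_heldFlow_le (hT : IsC0Semigroup T) {τ G χ : ℝ} (hτ : 0 < τ)
    (h : SampledDataExpStable T B f F τ G χ) (z : H) {s : ℝ} (hs : 0 ≤ s) (hsτ : s ≤ τ) :
    ‖heldFlow T B f F z s‖ ≤ G * Real.exp (-χ * s) * ‖z‖ := by
  let t : ℕ → EReal := fun k => ((k * τ : ℝ) : EReal)
  have ht : ∀ k : ℕ, t k = ((k * τ : ℝ) : EReal) := fun k => rfl
  have ht1 : ∀ k : ℕ, t (k + 1) = (((k + 1) * τ : ℝ) : EReal) := fun k => by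
    rw [ht]; push_cast; rfl
  obtain ⟨u, x, hmild, hx, hu, -⟩ := exists_solution_of_states hT B f F (t := t) hτ
    (by simp [t]) (fun k => by
      rw [ht, ht1, ← EReal.coe_add, EReal.coe_le_coe_iff]
      linarith)
    (fun k => (fun y => heldFlow T B f F y τ)^[k] z) (fun k => by
      rw [Function.iterate_succ_apply', ht1, ht, EReal.toReal_coe, EReal.toReal_coe]
      congr 1
      ring)
  have hb := h z u x (fun k r hr => by
    rw [hu k r (EReal.coe_le_coe_iff.2 hr.1) (by rw [ht1]; exact EReal.coe_lt_coe_iff.2 hr.2),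
      ht, EReal.toReal_coe]) hmild s hs
  have h0 := hx 0 s (by simpa [t] using hs) (by rw [ht1]; simpa using hsτ)
  simp only [ht, EReal.toReal_coe, Function.iterate_zero, id_eq] at h0
  rw [h0] at hb
  simpa using hb

/-! ### Estimates along the event-triggered closed loop -/

section Solution

variable {τ σ : ℝ} {x₀ : H} {t : ℕ → EReal} {u : ℝ → U} {x : ℝ → H}

theorem IsEventTriggeredSolution.add_le_succ
    (hx : IsEventTriggeredSolution T B f F V α γ τ σ x₀ t u x) (k : ℕ) :
    t k + (τ : EReal) ≤ t (k + 1) := by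
  rw [hx.time_succ k]
  refine le_sInf ?_
  rintro _ ⟨s, hs, rfl⟩
  exact hs.1

theorem IsEventTriggeredSolution.monotone
    (hx : IsEventTriggeredSolution T B f F V α γ τ σ x₀ t u x) (hτ : 0 < τ) : Monotone t :=
  monotone_nat_of_le_succ fun k => (le_add_of_real_step _ hτ).trans (hx.add_le_succ k)

theorem IsEventTriggeredSolution.nonneg
    (hx : IsEventTriggeredSolution T B f F V α γ τ σ x₀ t u x) (hτ : 0 < τ) (k : ℕ) :
    0 ≤ t k :=
  hx.time_zero ▸ hx.monotone hτ (Nat.zero_le k)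

theorem IsEventTriggeredSolution.eq_heldFlow
    (hx : IsEventTriggeredSolution T B f F V α γ τ σ x₀ t u x) (hT : IsC0Semigroup T) {k : ℕ}
    {a s : ℝ} (ha : 0 ≤ a) (hta : t k = (a : EReal)) (has : a ≤ s) (hs : (s : EReal) ≤ t (k + 1)) :
    x s = heldFlow T B f F (x a) (s - a) := by
  refine hT.eq_affineFlow_of_const hx.mild ha has fun r hr => ?_
  rw [hx.control k r (by rw [hta]; exact_mod_cast hr.1)
    (lt_of_lt_of_le (EReal.coe_lt_coe_iff.2 hr.2) hs), hta, EReal.toReal_coe]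

theorem IsEventTriggeredSolution.not_triggered
    (hx : IsEventTriggeredSolution T B f F V α γ τ σ x₀ t u x) {k : ℕ} {a s : ℝ}
    (hta : t k = (a : EReal)) (has : a + τ ≤ s) (hs : (s : EReal) < t (k + 1)) :
    (γ ‖B (f (F (x a)) - f (F (x s)))‖₊ : ℝ) < σ * α (V (x s)) := by
  by_contra hcon
  rw [hx.time_succ k] at hs
  refine (not_le.2 hs) (sInf_le (mem_image_of_mem _ ⟨?_, ?_⟩))
  · rw [hta, ← EReal.coe_add]
    exact_mod_cast has
  · rw [hta, EReal.toReal_coe]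
    exact not_lt.1 hcon

theorem IsEventTriggeredSolution.norm_le_of_le_add
    (hx : IsEventTriggeredSolution T B f F V α γ τ σ x₀ t u x) (hT : IsC0Semigroup T)
    (hτ : 0 < τ) {G χ : ℝ} (hsd : SampledDataExpStable T B f F τ G χ) {k : ℕ}
    {a s : ℝ} (ha : 0 ≤ a) (hta : t k = (a : EReal)) (has : a ≤ s) (hs : s ≤ a + τ) :
    ‖x s‖ ≤ G * Real.exp (-χ * (s - a)) * ‖x a‖ := by
  have h1 : (s : EReal) ≤ t (k + 1) := by
    refine le_trans ?_ (hx.add_le_succ k)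
    rw [hta, ← EReal.coe_add]
    exact_mod_cast hs
  rw [hx.eq_heldFlow hT ha hta has h1]
  exact hsd.norm_heldFlow_le hT hτ _ (by linarith) (by linarith)

theorem IsClassKInf.le_invFun_iff {ψ : ℝ≥0 → ℝ≥0} (hψ : IsClassKInf ψ) {r c : ℝ≥0} :
    r ≤ Function.invFun ψ c ↔ ψ r ≤ c := by
  have hex : ∃ a, ψ a = c := by
    obtain ⟨b, hb⟩ := (hψ.tendsto.eventually (eventually_ge_atTop c)).exists
    obtain ⟨a, -, ha⟩ := intermediate_value_Icc (zero_le : 0 ≤ b) hψ.continuous.continuousOn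
      ⟨by rw [hψ.map_zero]; exact zero_le, hb⟩
    exact ⟨a, ha⟩
  rw [← hψ.strictMono.le_iff_le, Function.invFun_eq hex]

theorem monotone_gainRho {κ : ℝ≥0 → ℝ≥0 → ℝ≥0} (hψ₁ : IsClassKInf ψ₁) (hψ₂ : IsClassKInf ψ₂)
    (hκ : IsClassKL κ) (G χ τ : ℝ) (n : ℝ≥0) :
    Monotone fun m => gainRho ψ₁ ψ₂ κ G χ τ m n := by
  intro m m' hm
  refine hψ₁.le_invFun_iff.2 ((hψ₁.le_invFun_iff.1 le_rfl).trans ?_)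
  exact (hκ.strictMono n).monotone (hψ₂.strictMono.monotone (by gcongr))

/-- After the waiting time, the state is controlled by the gain `ρ` until the next update: the
sampled-data bound covers the waiting time, the Lyapunov function the remainder. -/
theorem IsEventTriggeredSolution.nnnorm_le_gainRho
    (hx : IsEventTriggeredSolution T B f F V α γ τ σ x₀ t u x) (hT : IsC0Semigroup T)
    (hτ : 0 < τ) {G χ : ℝ} (hG : 0 ≤ G) (hsd : SampledDataExpStable T B f F τ G χ)
    (hV : IsCoerciveISSLyapunov T B f F V ψ₁ ψ₂ α γ) {L : ℝ≥0}
    (hf : LipschitzWith L (fun x : H => f (F x))) (hσ : σ < 1)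
    {κ : ℝ≥0 → ℝ≥0 → ℝ≥0} (hκ : IsClassKL κ) (hcomp : IsComparisonBound σ α κ) {k : ℕ}
    {a : ℝ} (ha : 0 ≤ a) (hta : t k = (a : EReal)) {l : ℝ≥0}
    (hl : ((a + τ + l : ℝ) : EReal) ≤ t (k + 1)) :
    ‖x (a + τ + l)‖₊ ≤ gainRho ψ₁ ψ₂ κ G χ τ ‖x a‖₊ l := by
  have hl0 : (0 : ℝ) ≤ l := l.2
  have hflow : ∀ r : ℝ, 0 ≤ r → r ≤ τ + l → x (a + r) = heldFlow T B f F (x a) r := by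
    intro r hr hrl
    have := hx.eq_heldFlow hT ha hta (le_add_of_nonneg_right hr)
      ((EReal.coe_le_coe_iff.2 (by linarith)).trans hl)
    rwa [add_sub_cancel_left] at this
  have hdec : V (x (a + τ + l)) ≤ κ (V (x (a + τ))) l := by
    rw [add_assoc, hflow (τ + l) (by positivity) le_rfl, hflow τ hτ.le (by linarith)]
    refine hV.heldFlow_le_of_Ico hT hf hσ hκ hcomp hτ.le fun s hs => ?_
    have hs0 : 0 ≤ s := hτ.le.trans hs.1
    rw [← hflow s hs0 hs.2.le]
    refine hx.not_triggered hta (by linarith [hs.1]) (lt_of_lt_of_le ?_ hl)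
    rw [EReal.coe_lt_coe_iff]
    linarith [hs.2]
  have hwait : ‖x (a + τ)‖₊ ≤ Real.toNNReal (G * Real.exp (-χ * τ)) * ‖x a‖₊ := by
    have := hx.norm_le_of_le_add hT hτ hsd ha hta (by linarith) (le_refl (a + τ))
    rw [add_sub_cancel_left] at this
    rw [← NNReal.coe_le_coe, NNReal.coe_mul, Real.coe_toNNReal _ (by positivity)]
    exact this
  refine hV.psi₁.le_invFun_iff.2 ((hV.lower _).trans (hdec.trans ?_))
  exact (hκ.strictMono l).monotone
    ((hV.upper _).trans (hV.psi₂.strictMono.monotone hwait))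

theorem gainIterate_congr (ρ : ℝ≥0 → ℝ≥0 → ℝ≥0) (m : ℝ≥0) {n n' : ℕ → ℝ≥0} {K : ℕ}
    (h : ∀ j ≤ K, n j = n' j) : gainIterate ρ m n K = gainIterate ρ m n' K := by
  induction K with
  | zero => rfl
  | succ K ih => rw [gainIterate, gainIterate, ih fun j hj => h j (by omega), h _ le_rfl]

/-- Appending one more waiting time and decay time to an estimate by iterated gains. -/
theorem exists_gainIterate_succ {ρ : ℝ≥0 → ℝ≥0 → ℝ≥0} (hρ : ∀ n, Monotone fun m => ρ m n)
    {m v v' l : ℝ≥0} {a τ : ℝ} {K : ℕ}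
    (h : ∃ n : ℕ → ℝ≥0, v ≤ gainIterate ρ m n K ∧
      a = K * τ + ((∑ j ∈ Finset.Icc 1 K, n j : ℝ≥0) : ℝ)) (hv : v' ≤ ρ v l) :
    ∃ n : ℕ → ℝ≥0, v' ≤ gainIterate ρ m n (K + 1) ∧
      a + τ + l = ((K + 1 : ℕ) : ℝ) * τ + ((∑ j ∈ Finset.Icc 1 (K + 1), n j : ℝ≥0) : ℝ) := by
  obtain ⟨n, hn, ha⟩ := h
  have hold : ∀ j ≤ K, Function.update n (K + 1) l j = n j := fun j hj =>
    Function.update_of_ne (by omega) _ _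
  refine ⟨Function.update n (K + 1) l, ?_, ?_⟩
  · rw [gainIterate, gainIterate_congr ρ m hold, Function.update_self]
    exact hv.trans (hρ l hn)
  · rw [Finset.sum_Icc_succ_top (by omega), Function.update_self,
      Finset.sum_congr rfl fun j hj => hold j (Finset.mem_Icc.1 hj).2, ha]
    push_cast
    ring

/-- At the update times, the state is bounded by iterated gains, and the elapsed time is the sum
of the waiting times `τ` and of the decay times fed into the iteration. -/
theorem IsEventTriggeredSolution.exists_gainIterate
    (hx : IsEventTriggeredSolution T B f F V α γ τ σ x₀ t u x) (hT : IsC0Semigroup T)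
    (hτ : 0 < τ) {G χ : ℝ} (hG : 0 ≤ G) (hsd : SampledDataExpStable T B f F τ G χ)
    (hV : IsCoerciveISSLyapunov T B f F V ψ₁ ψ₂ α γ) {L : ℝ≥0}
    (hf : LipschitzWith L (fun x : H => f (F x))) (hσ : σ < 1)
    {κ : ℝ≥0 → ℝ≥0 → ℝ≥0} (hκ : IsClassKL κ) (hcomp : IsComparisonBound σ α κ) :
    ∀ (k : ℕ) (a : ℝ), t k = (a : EReal) → ∃ n : ℕ → ℝ≥0,
      ‖x a‖₊ ≤ gainIterate (gainRho ψ₁ ψ₂ κ G χ τ) ‖x₀‖₊ n k ∧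
      a = k * τ + ((∑ j ∈ Finset.Icc 1 k, n j : ℝ≥0) : ℝ) := by
  intro k
  induction k with
  | zero =>
    intro a ha
    have ha0 : a = 0 := by
      rw [hx.time_zero] at ha
      exact_mod_cast ha.symm
    have hx0 : x 0 = x₀ := by
      have := hx.mild.eq 0 le_rfl
      simpa [hT.apply_zero] using this
    refine ⟨0, ?_, ?_⟩
    · rw [ha0, hx0, gainIterate]
    · simp [ha0]
  | succ k ih =>
    intro a' ha'
    have hk := hx.add_le_succ k
    have hk0 := hx.nonneg hτ k
    obtain ⟨a, ha⟩ : ∃ a : ℝ, t k = (a : EReal) := by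
      refine ⟨_, (EReal.coe_toReal (fun h => ?_) (fun h => ?_)).symm⟩
      · have := hx.monotone hτ (Nat.le_succ k)
        rw [h, ha'] at this
        exact absurd this (not_le.2 (EReal.coe_lt_top a'))
      · rw [h] at hk0; simp at hk0
    rw [ha] at hk0
    rw [ha, ha', ← EReal.coe_add, EReal.coe_le_coe_iff] at hk
    obtain ⟨l, hl⟩ : ∃ l : ℝ≥0, a' = a + τ + l :=
      ⟨Real.toNNReal (a' - (a + τ)), by rw [Real.coe_toNNReal _ (sub_nonneg.2 hk)]; ring⟩
    have hρ := hx.nnnorm_le_gainRho hT hτ hG hsd hV hf hσ hκ hcomp (by exact_mod_cast hk0) ha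
      (l := l) (by rw [← hl, ha'])
    rw [hl]
    exact exists_gainIterate_succ (monotone_gainRho hV.psi₁ hV.psi₂ hκ G χ τ) (ih a ha) hρ

end Solution

end ClosedLoop

section Existence

variable {𝕜 : Type*} [RCLike 𝕜]
  {H : Type*} [NormedAddCommGroup H] [InnerProductSpace 𝕜 H] [NormedSpace ℝ H]
  [IsScalarTower ℝ 𝕜 H] [CompleteSpace H]
  {U : Type*} [NormedAddCommGroup U] [InnerProductSpace 𝕜 U] [CompleteSpace U]
  {T : ℝ → H →L[𝕜] H} {B : U →L[𝕜] H} {f : U → U} {F : H →L[𝕜] U}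

/-! ### Existence of event-triggered solutions -/

/-- An infimum, taken in the extended reals, of a closed set of reals belongs to the set, if it
is a real number. -/
theorem mem_of_sInf_eq_coe {E : Set ℝ} (hE : IsClosed E) {c : ℝ}
    (h : sInf ((fun s : ℝ => (s : EReal)) '' E) = (c : EReal)) : c ∈ E := by
  have hne : ((fun s : ℝ => (s : EReal)) '' E).Nonempty := by
    by_contra hcon
    rw [not_nonempty_iff_eq_empty.1 hcon, sInf_empty] at h
    exact EReal.coe_ne_top c h.symm
  have hcl := csInf_mem_closure hne (OrderBot.bddBelow _)
  rw [h] at hcl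
  have := EReal.isEmbedding_coe.isInducing.closure_eq_preimage_closure_image E
  rw [hE.closure_eq] at this
  rw [this]
  exact hcl

/-- The event-triggered closed loop has a solution from every initial state. Update times and
states are defined recursively from the continued held control; as the triggering sets are closed,
replacing the continuation by the true solution does not change their infima. -/
theorem exists_isEventTriggeredSolution (hT : IsC0Semigroup T) {V : H → ℝ≥0} (hVc : Continuous V)
    {α γ : ℝ≥0 → ℝ≥0} (hα : Continuous α) (hγ : Continuous γ) {L : ℝ≥0}
    (hf : LipschitzWith L (fun x : H => f (F x))) {τ σ : ℝ} (hτ : 0 < τ) (x₀ : H) :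
    ∃ (t : ℕ → EReal) (u : ℝ → U) (x : ℝ → H),
      IsEventTriggeredSolution T B f F V α γ τ σ x₀ t u x := by
  -- the triggering set computed from the held control continued beyond the next event; it is empty
  -- for `r = ⊤`
  let E : EReal → H → Set ℝ := fun r z => {s : ℝ | r + (τ : EReal) ≤ (s : EReal) ∧
    σ * (α (V (heldFlow T B f F z (s - r.toReal))) : ℝ) ≤
      (γ ‖B (f (F z) - f (F (heldFlow T B f F z (s - r.toReal))))‖₊ : ℝ)}
  let next : EReal × H → EReal × H := fun p =>
    (sInf ((fun s : ℝ => (s : EReal)) '' E p.1 p.2),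
      heldFlow T B f F p.2
        ((sInf ((fun s : ℝ => (s : EReal)) '' E p.1 p.2)).toReal - p.1.toReal))
  let t : ℕ → EReal := fun k => (next^[k] (0, x₀)).1
  let z : ℕ → H := fun k => (next^[k] (0, x₀)).2
  have ht : ∀ k, t (k + 1) = sInf ((fun s : ℝ => (s : EReal)) '' E (t k) (z k)) := fun k => by
    simp only [t, z, Function.iterate_succ_apply']
    rfl
  have hz : ∀ k, z (k + 1) = heldFlow T B f F (z k) ((t (k + 1)).toReal - (t k).toReal) :=
    fun k => by
      rw [ht]
      simp only [t, z, Function.iterate_succ_apply']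
      rfl
  have h0 : t 0 = 0 := rfl
  have hstep : ∀ k, t k + (τ : EReal) ≤ t (k + 1) := fun k => by
    rw [ht]
    refine le_sInf ?_
    rintro _ ⟨s, hs, rfl⟩
    exact hs.1
  have hmono : Monotone t :=
    monotone_nat_of_le_succ fun k => (le_add_of_real_step _ hτ).trans (hstep k)
  have hclosed : ∀ (a : ℝ) (y : H), IsClosed (E a y) := by
    intro a y
    have hflow : Continuous fun s : ℝ => heldFlow T B f F y (max (s - a) 0) :=
      ((hT.continuous_affineFlow (b := fun z => B (f (F z)))
        (B.continuous.comp hf.continuous)).comp (Continuous.prodMk_right y)).comp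
          (continuous_id.sub continuous_const)
    have hE : E a y = {s : ℝ | a + τ ≤ s} ∩
        {s : ℝ | σ * (α (V (heldFlow T B f F y (max (s - a) 0))) : ℝ) ≤
          (γ ‖B (f (F y) - f (F (heldFlow T B f F y (max (s - a) 0))))‖₊ : ℝ)} := by
      ext s
      have h1 : ((a : EReal) + (τ : EReal) ≤ (s : EReal)) ↔ a + τ ≤ s := by
        rw [← EReal.coe_add, EReal.coe_le_coe_iff]
      simp only [E, mem_inter_iff, mem_ofPred_eq, EReal.toReal_coe, h1]
      refine and_congr_right fun hs => ?_
      rw [max_eq_left (by linarith)]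
    rw [hE]
    refine (isClosed_le continuous_const continuous_id).inter (isClosed_le ?_ ?_)
    · exact continuous_const.mul (NNReal.continuous_coe.comp (hα.comp (hVc.comp hflow)))
    · exact NNReal.continuous_coe.comp (hγ.comp (continuous_nnnorm.comp
        (B.continuous.comp (continuous_const.sub (hf.continuous.comp hflow)))))
  obtain ⟨u, x, hmild, hx, hu, hxt⟩ := exists_solution_of_states hT B f F hτ h0 hstep z hz
  refine ⟨t, u, x, h0, fun k => ?_, hu, hmild⟩
  by_cases htop : t k = ⊤
  · have h1 : t (k + 1) = ⊤ := top_le_iff.1 (htop ▸ hmono (Nat.le_succ k))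
    rw [h1, eq_comm, sInf_eq_top]
    rintro _ ⟨s, hs, rfl⟩
    have h2 := hs.1
    rw [htop, EReal.top_add_coe] at h2
    exact absurd h2 (not_le.2 (EReal.coe_lt_top s))
  obtain ⟨a, ha⟩ : ∃ a : ℝ, t k = (a : EReal) := by
    refine ⟨_, (EReal.coe_toReal htop fun h => ?_).symm⟩
    have : t 0 ≤ t k := hmono (Nat.zero_le k)
    rw [h, h0] at this
    simp at this
  rw [hxt k htop]
  -- up to the next update the solution is the continued held control
  have hiff : ∀ s : ℝ, (s : EReal) ≤ t (k + 1) → (s ∈ E (t k) (z k) ↔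
      t k + (τ : EReal) ≤ (s : EReal) ∧
        σ * (α (V (x s)) : ℝ) ≤ (γ ‖B (f (F (z k)) - f (F (x s)))‖₊ : ℝ)) := by
    intro s hs
    refine and_congr_right fun hks => ?_
    rw [hx k s ((le_add_of_real_step _ hτ).trans hks) hs]
  refine le_antisymm (le_sInf ?_) ?_
  · rintro _ ⟨s, hs, rfl⟩
    rcases le_total (s : EReal) (t (k + 1)) with h | h
    · rw [ht]
      exact sInf_le (mem_image_of_mem _ ((hiff s h).2 hs))
    · exact h
  · by_cases hk1 : t (k + 1) = ⊤
    · rw [hk1]; exact le_top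
    · obtain ⟨c, hc⟩ : ∃ c : ℝ, t (k + 1) = (c : EReal) := by
        refine ⟨_, (EReal.coe_toReal hk1 fun h => ?_).symm⟩
        have : t 0 ≤ t (k + 1) := hmono (Nat.zero_le _)
        rw [h, h0] at this
        simp at this
      have hmem : c ∈ E (t k) (z k) :=
        mem_of_sInf_eq_coe (by rw [ha]; exact hclosed a _) (by rw [← ht, hc])
      rw [hc]
      exact sInf_le (mem_image_of_mem (fun s : ℝ => (s : EReal)) ((hiff c hc.ge).1 hmem))

end Existence

section Gain

/-! ### From iterated gains to a bound of class `KL` -/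

/-- A bound by `K` iterated gains decays in the elapsed time `s`: either `K` is at least `√s`, or
one of the decay times is at least `√s - τ`. -/
theorem gain_le_of_elapsed {μ : ℝ≥0 → ℝ≥0 → ℝ≥0} {ω : ℝ≥0 → ℝ≥0} (hμ : IsClassKL μ)
    (hω : IsClassL ω) {τ m s : ℝ≥0} {K : ℕ} {n : ℕ → ℝ≥0}
    (hs : s = K * τ + ∑ j ∈ Finset.Icc 1 K, n j) :
    μ (ω K * m) ((Finset.Icc 1 K).sup n) ≤
      μ (ω (NNReal.sqrt s) * m) 0 + μ (ω 0 * m) (NNReal.sqrt s - τ) := by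
  set l := (Finset.Icc 1 K).sup n with hl
  rcases le_or_gt (NNReal.sqrt s) K with h | h
  · refine le_add_right (((hμ.strictMono l).monotone ?_).trans (hμ.antitone _ zero_le))
    gcongr
    exact hω.antitone h
  · refine le_add_left (((hμ.strictMono l).monotone ?_).trans (hμ.antitone _ ?_))
    · gcongr
      exact hω.antitone zero_le
    · have hsum : ∑ j ∈ Finset.Icc 1 K, n j ≤ K * l := by
        have := Finset.sum_le_card_nsmul (Finset.Icc 1 K) n l fun j hj => Finset.le_sup hj
        simpa using this
      have h1 : NNReal.sqrt s * NNReal.sqrt s ≤ NNReal.sqrt s * (τ + l) := by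
        rw [NNReal.mul_self_sqrt]
        calc s ≤ K * (τ + l) := by rw [hs, mul_add]; gcongr
          _ ≤ _ := by gcongr
      have hpos : 0 < NNReal.sqrt s := lt_of_le_of_lt zero_le h
      rw [tsub_le_iff_left]
      exact le_of_mul_le_mul_left h1 hpos

theorem tendsto_tsub_const_atTop (c : ℝ≥0) : Tendsto (fun s : ℝ≥0 => s - c) atTop atTop := by
  refine tendsto_atTop.2 fun b => ?_
  filter_upwards [eventually_ge_atTop (b + c)] with s hs
  exact le_tsub_of_add_le_right hs

theorem tendsto_nnrealSqrt_atTop : Tendsto NNReal.sqrt atTop atTop := by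
  refine tendsto_atTop.2 fun b => ?_
  filter_upwards [eventually_ge_atTop (b * b)] with s hs
  calc b = NNReal.sqrt (b * b) := (NNReal.sqrt_mul_self b).symm
    _ ≤ _ := NNReal.sqrt_le_sqrt.2 hs

theorem isClassKL_decay {μ : ℝ≥0 → ℝ≥0 → ℝ≥0} {ω : ℝ≥0 → ℝ≥0} (hμ : IsClassKL μ)
    (hω : IsClassL ω) {G : ℝ≥0} (hG : 0 < G) (τ : ℝ≥0) :
    IsClassKL fun m s => G * (μ (ω (NNReal.sqrt (s - τ)) * m) 0 +
      μ (ω 0 * m) (NNReal.sqrt (s - τ) - τ) + Real.toNNReal (Real.exp (τ - s)) * m) where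
  continuous := by
    have hc1 : Continuous fun p : ℝ≥0 × ℝ≥0 => NNReal.sqrt (p.2 - τ) := by fun_prop
    have h1 : Continuous fun p : ℝ≥0 × ℝ≥0 => μ (ω (NNReal.sqrt (p.2 - τ)) * p.1) 0 :=
      hμ.continuous.comp (((hω.continuous.comp hc1).mul continuous_fst).prodMk continuous_const)
    have h2 : Continuous fun p : ℝ≥0 × ℝ≥0 => μ (ω 0 * p.1) (NNReal.sqrt (p.2 - τ) - τ) :=
      hμ.continuous.comp ((continuous_const.mul continuous_fst).prodMk
        (hc1.sub continuous_const))
    have h3 : Continuous fun p : ℝ≥0 × ℝ≥0 => Real.toNNReal (Real.exp (τ - p.2)) :=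
      continuous_real_toNNReal.comp (by fun_prop)
    exact continuous_const.mul ((h1.add h2).add (h3.mul continuous_fst))
  strictMono l := by
    intro m m' hm
    have h1 := (hμ.strictMono 0).monotone (mul_le_mul_right hm.le (ω (NNReal.sqrt (l - τ))))
    have h2 := (hμ.strictMono (NNReal.sqrt (l - τ) - τ)).monotone (mul_le_mul_right hm.le (ω 0))
    have h3 : 0 < Real.toNNReal (Real.exp (τ - l)) := Real.toNNReal_pos.2 (Real.exp_pos _)
    exact mul_lt_mul_of_pos_left (add_lt_add_of_le_of_lt (add_le_add h1 h2)
      (mul_lt_mul_of_pos_left hm h3)) hG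
  map_zero l := by simp [hμ.map_zero]
  antitone m := by
    intro s s' hs
    have h1 : NNReal.sqrt (s - τ) ≤ NNReal.sqrt (s' - τ) :=
      NNReal.sqrt_le_sqrt.2 (tsub_le_tsub_right hs τ)
    refine mul_le_mul_right (add_le_add (add_le_add ?_ ?_) ?_) _
    · exact (hμ.strictMono 0).monotone (mul_le_mul_left (hω.antitone h1) m)
    · exact hμ.antitone _ (tsub_le_tsub_right h1 τ)
    · gcongr
  tendsto m := by
    have hs : Tendsto (fun s : ℝ≥0 => NNReal.sqrt (s - τ)) atTop atTop :=
      tendsto_nnrealSqrt_atTop.comp (tendsto_tsub_const_atTop τ)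
    have h1 : Tendsto (fun s : ℝ≥0 => μ (ω (NNReal.sqrt (s - τ)) * m) 0) atTop (𝓝 0) := by
      have hc : Continuous fun r => μ (r * m) 0 :=
        hμ.continuous.comp ((continuous_id.mul continuous_const).prodMk continuous_const)
      have := (hc.tendsto 0).comp (hω.tendsto.comp hs)
      simpa [hμ.map_zero, Function.comp_def] using this
    have h2 : Tendsto (fun s : ℝ≥0 => μ (ω 0 * m) (NNReal.sqrt (s - τ) - τ)) atTop (𝓝 0) :=
      (hμ.tendsto _).comp ((tendsto_tsub_const_atTop τ).comp hs)
    have h3 : Tendsto (fun s : ℝ≥0 => Real.toNNReal (Real.exp (τ - s))) atTop (𝓝 0) := by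
      have e1 : Tendsto (fun s : ℝ≥0 => (τ : ℝ) - s) atTop atBot :=
        tendsto_atBot_add_const_left _ (τ : ℝ)
          (tendsto_neg_atTop_atBot.comp (NNReal.tendsto_coe_atTop.2 tendsto_id))
      have := (continuous_real_toNNReal.tendsto 0).comp (Real.tendsto_exp_atBot.comp e1)
      simpa [Function.comp_def] using this
    have := ((h1.add h2).add (h3.mul_const m)).const_mul G
    simpa using this

end Gain

section Stability

variable {𝕜 : Type*} [RCLike 𝕜]
  {H : Type*} [NormedAddCommGroup H] [InnerProductSpace 𝕜 H] [NormedSpace ℝ H]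
  [IsScalarTower ℝ 𝕜 H] [CompleteSpace H]
  {U : Type*} [NormedAddCommGroup U] [InnerProductSpace 𝕜 U] [CompleteSpace U]
  {T : ℝ → H →L[𝕜] H} {B : U →L[𝕜] H} {f : U → U} {F : H →L[𝕜] U}
  {V : H → ℝ≥0} {ψ₁ ψ₂ α γ : ℝ≥0 → ℝ≥0}

/-! ### Decay of event-triggered solutions -/

/-- Under the gain condition, solutions of the event-triggered closed loop obey the decay estimate
of class `KL`. During the waiting time the estimate at the last update is used, hence the shift
by `τ`; the exponential term covers the first waiting time. -/
theorem IsEventTriggeredSolution.nnnorm_le_decay {τ : ℝ≥0} {σ : ℝ} {x₀ : H} {t : ℕ → EReal}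
    {u : ℝ → U} {x : ℝ → H} (hx : IsEventTriggeredSolution T B f F V α γ τ σ x₀ t u x)
    (hT : IsC0Semigroup T) (hτ : 0 < τ) {G : ℝ≥0} (hG : 1 ≤ G) {χ : ℝ} (hχ : 0 < χ)
    (hsd : SampledDataExpStable T B f F τ G χ)
    (hV : IsCoerciveISSLyapunov T B f F V ψ₁ ψ₂ α γ) {L : ℝ≥0}
    (hf : LipschitzWith L (fun x : H => f (F x))) (hσ : σ < 1)
    {κ : ℝ≥0 → ℝ≥0 → ℝ≥0} (hκ : IsClassKL κ) (hcomp : IsComparisonBound σ α κ)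
    {μ : ℝ≥0 → ℝ≥0 → ℝ≥0} {ω : ℝ≥0 → ℝ≥0} (hμ : IsClassKL μ) (hω : IsClassL ω)
    (hgain : ∀ K : ℕ, 1 ≤ K → ∀ (m : ℝ≥0) (n : ℕ → ℝ≥0),
      gainIterate (gainRho ψ₁ ψ₂ κ G χ τ) m n K ≤ μ (ω K * m) ((Finset.Icc 1 K).sup n))
    (s : ℝ≥0) :
    ‖x s‖₊ ≤ G * (μ (ω (NNReal.sqrt (s - τ)) * ‖x₀‖₊) 0 +
      μ (ω 0 * ‖x₀‖₊) (NNReal.sqrt (s - τ) - τ) +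
        Real.toNNReal (Real.exp (τ - s)) * ‖x₀‖₊) := by
  have hτ' : (0 : ℝ) < τ := hτ
  have hG0 : (0 : ℝ) ≤ G := G.2
  set m := ‖x₀‖₊ with hm
  -- the part of the estimate that comes from the gain condition, at elapsed time `r`
  let β : ℝ≥0 → ℝ≥0 := fun r =>
    μ (ω (NNReal.sqrt r) * m) 0 + μ (ω 0 * m) (NNReal.sqrt r - τ)
  have hβ : Antitone β := fun r r' h => by
    have h1 := NNReal.sqrt_le_sqrt.2 h
    refine add_le_add ?_ ?_
    · exact (hμ.strictMono 0).monotone (mul_le_mul_left (hω.antitone h1) m)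
    · exact hμ.antitone _ (tsub_le_tsub_right h1 τ)
  have hbound : ∀ (K : ℕ) (v r : ℝ≥0), 1 ≤ K → (∃ n : ℕ → ℝ≥0,
      v ≤ gainIterate (gainRho ψ₁ ψ₂ κ G χ τ) m n K ∧
        (r : ℝ) = K * τ + ((∑ j ∈ Finset.Icc 1 K, n j : ℝ≥0) : ℝ)) → v ≤ β r := by
    rintro K v r hK ⟨n, hn, hr⟩
    exact (hn.trans (hgain K hK m n)).trans (gain_le_of_elapsed hμ hω (by exact_mod_cast hr))
  have hgoal : ∀ v : ℝ≥0, v ≤ β (s - τ) → G * v ≤ G * (β (s - τ) +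
      Real.toNNReal (Real.exp (τ - s)) * m) := fun v hv => by
    gcongr
    exact le_add_right hv
  have hupd := hx.exists_gainIterate hT hτ' hG0 hsd hV hf hσ hκ hcomp
  obtain ⟨k, hk, hk'⟩ := exists_update_interval hτ' hx.time_zero hx.add_le_succ s.2
  obtain ⟨a, ha⟩ : ∃ a : ℝ, t k = (a : EReal) := by
    refine ⟨_, (EReal.coe_toReal (fun h => ?_) (fun h => ?_)).symm⟩
    · rw [h] at hk; exact absurd hk (not_le.2 (EReal.coe_lt_top _))
    · have := hx.nonneg hτ' k
      rw [h] at this; simp at this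
  have ha0 : 0 ≤ a := by have := hx.nonneg hτ' k; rw [ha] at this; exact_mod_cast this
  have has : a ≤ s := by rw [ha] at hk; exact_mod_cast hk
  rcases le_total (a + τ) s with hwait | hwait
  · obtain ⟨l, hl⟩ : ∃ l : ℝ≥0, (s : ℝ) = a + τ + l :=
      ⟨Real.toNNReal (s - (a + τ)), by rw [Real.coe_toNNReal _ (sub_nonneg.2 hwait)]; ring⟩
    have hρ := hx.nnnorm_le_gainRho hT hτ' hG0 hsd hV hf hσ hκ hcomp ha0 ha
      (l := l) (by rw [← hl]; exact hk'.le)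
    have h1 := hbound (k + 1) _ s (by omega) (by
      rw [hl]
      exact exists_gainIterate_succ (monotone_gainRho hV.psi₁ hV.psi₂ hκ G χ τ) (hupd k a ha) hρ)
    rw [← hl] at h1
    have h2 := hgoal _ (h1.trans (hβ tsub_le_self))
    exact (le_mul_of_one_le_left zero_le hG).trans h2
  · have h1 : ‖x s‖₊ ≤ G * ‖x a‖₊ := by
      have := hx.norm_le_of_le_add hT hτ' hsd ha0 ha has hwait
      rw [← NNReal.coe_le_coe]
      refine this.trans ?_
      push_cast
      gcongr
      refine mul_le_of_le_one_right hG0 (Real.exp_le_one_iff.2 ?_)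
      nlinarith
    refine h1.trans ?_
    rcases Nat.eq_zero_or_pos k with rfl | hkpos
    · have ha00 : a = 0 := by
        have h := hx.time_zero
        rw [ha] at h
        exact_mod_cast h
      have hx0 : x a = x₀ := by
        have := hx.mild.eq 0 le_rfl
        rw [ha00]
        simpa [hT.apply_zero] using this
      rw [hx0]
      gcongr
      refine le_add_left (le_mul_of_one_le_left zero_le ?_)
      rw [Real.one_le_toNNReal, Real.one_le_exp_iff]
      linarith
    · refine hgoal _ ((hbound k _ a.toNNReal hkpos ?_).trans (hβ ?_))
      · rw [Real.coe_toNNReal a ha0]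
        exact hupd k a ha
      · rw [tsub_le_iff_right, ← NNReal.coe_le_coe, NNReal.coe_add, Real.coe_toNNReal a ha0]
        exact hwait

end Stability

/-! ### Stability of the closed loops -/

theorem mainTheorem1
    {𝕜 : Type*} [RCLike 𝕜]
    {H : Type*} [NormedAddCommGroup H] [InnerProductSpace 𝕜 H] [NormedSpace ℝ H]
    [IsScalarTower ℝ 𝕜 H] [CompleteSpace H]
    {U : Type*} [NormedAddCommGroup U] [InnerProductSpace 𝕜 U] [CompleteSpace U]
    -- the plant: `A` generates the `C₀`-semigroup `T`, and `B` is bounded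
    (A : H →ₗ.[𝕜] H) (T : ℝ → H →L[𝕜] H) (hT : IsC0Semigroup T) (hA : IsGenerator A T)
    (M ν₀ : ℝ) (hM : 1 ≤ M) (hν₀ : 0 < ν₀)
    (hTbound : ∀ t : ℝ, 0 ≤ t → ‖T t‖ ≤ M * Real.exp (ν₀ * t))
    (B : U →L[𝕜] H)
    -- exponential stabilizability by the compact feedback `F`
    (F : H →L[𝕜] U) (hF : IsCompactOperator F)
    (S : ℝ → H →L[𝕜] H) (hS : IsC0Semigroup S)
    (hABF : IsGenerator (((B.comp F : H →L[𝕜] H) : H →ₗ[𝕜] H) +ᵥ A) S)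
    (N ξ : ℝ) (hN : 1 ≤ N) (hξ : 0 < ξ)
    (hSbound : ∀ t : ℝ, 0 ≤ t → ‖S t‖ ≤ N * Real.exp (-ξ * t))
    -- the nonlinearity: Lipschitz and sector conditions, with a small sector bound
    (f : U → U) (hfLip : ∃ L : ℝ≥0, LipschitzWith L (fun x : H => f (F x)))
    (θ : ℝ) (hθ : 0 < θ) (hsector : ∀ x : H, ‖f (F x) - F x‖ ≤ θ * ‖x‖)
    (hθsmall : θ * (M * N * ‖B‖) < ξ) :
    -- sampled-data control is exponentially stabilizing for all small enough periods
    (∃ τs : ℝ, 0 < τs ∧ ∀ τ : ℝ, 0 < τ → τ < τs →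
      ∃ G χ : ℝ, 1 ≤ G ∧ 0 < χ ∧ SampledDataExpStable T B f F τ G χ) ∧
    -- for every period `τ` and constants `G, χ` of this kind: stability of the closed loop
    (∀ τ G χ : ℝ, 0 < τ → 1 ≤ G → 0 < χ → SampledDataExpStable T B f F τ G χ →
      ∀ (V : H → ℝ≥0) (ψ₁ ψ₂ α γ : ℝ≥0 → ℝ≥0),
      IsCoerciveISSLyapunov T B f F V ψ₁ ψ₂ α γ →
      ∀ σ : ℝ, 0 < σ → σ < 1 →
      ∀ κ : ℝ≥0 → ℝ≥0 → ℝ≥0, IsClassKL κ → IsComparisonBound σ α κ →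
      (∃ (μ : ℝ≥0 → ℝ≥0 → ℝ≥0) (ω : ℝ≥0 → ℝ≥0), IsClassKL μ ∧ IsClassL ω ∧
        ∀ (K : ℕ), 1 ≤ K → ∀ (m : ℝ≥0) (n : ℕ → ℝ≥0),
          gainIterate (gainRho ψ₁ ψ₂ κ G χ τ) m n K ≤
            μ (ω K * m) ((Finset.Icc 1 K).sup n)) →
      ∃ ν : ℝ≥0 → ℝ≥0 → ℝ≥0, IsClassKL ν ∧ ∀ x₀ : H,
        (∃ (t : ℕ → EReal) (u : ℝ → U) (x : ℝ → H),
          IsEventTriggeredSolution T B f F V α γ τ σ x₀ t u x) ∧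
        ∀ (t : ℕ → EReal) (u : ℝ → U) (x : ℝ → H),
          IsEventTriggeredSolution T B f F V α γ τ σ x₀ t u x →
          ∀ s : ℝ≥0, ‖x s‖₊ ≤ ν ‖x₀‖₊ s) := by
  obtain ⟨L, hf⟩ := hfLip
  refine ⟨?_, ?_⟩
  · have hsmall : θ * (N * ‖B‖) < ξ := by
      refine lt_of_le_of_lt (mul_le_mul_of_nonneg_left ?_ hθ.le) hθsmall
      rw [mul_assoc]
      exact le_mul_of_one_le_left (by positivity) hM
    exact exists_sampledDataExpStable hT hS hF (hasGeneratorValue_of_vadd hA hABF) hN hξ hSbound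
      hθ hsector hsmall
  · intro τ G χ hτ hG hχ hsd V ψ₁ ψ₂ α γ hV σ _ hσ κ hκ hcomp ⟨μ, ω, hμ, hω, hgain⟩
    lift τ to ℝ≥0 using hτ.le
    lift G to ℝ≥0 using zero_le_one.trans hG
    have hτ' : 0 < τ := by exact_mod_cast hτ
    have hG' : 1 ≤ G := by exact_mod_cast hG
    exact ⟨_, isClassKL_decay hμ hω (zero_lt_one.trans_le hG') τ, fun x₀ =>
      ⟨exists_isEventTriggeredSolution hT hV.continuous hV.alpha.continuous hV.gamma.continuous
        hf hτ x₀,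
      fun t u x hx s => hx.nnnorm_le_decay hT hτ' hG' hχ hsd hV hf hσ hκ hcomp hμ hω hgain s⟩⟩
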